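/- Conventions. A polytope $Q$ is the convex hull of a finite subset of a real vector space; its faces, which include $\emptyset$ and $Q$, form a finite lattice $\Gamma=\mathrm{face}(Q)$ under inclusion, with rank function $\rho(G)=\dim G+1$ (where $\dim\emptyset=-1$). Elements of the incidence algebra $I(\Gamma)$ are functions $p$ assigning to $z\le z'$ in $\Gamma$ a polynomial $p(z,z')\in\mathbb Z[t]$, with the convolution product. Put $\kappa(z,z')=(t-1)^{\rho(z')-\rho(z)}$ (the Eulerian kernel). For $p\in I(\Gamma)$ with $\deg p(z,z')\le\rho(z')-\rho(z)$ for all $z\le z'$, put $p^{\mathrm{rev}}(z,z';t)=t^{\rho(z')-\rho(z)}p(z,z';t^{-1})$. Let $g_\Gamma\in I(\Gamma)$ be the unique element with $g_\Gamma(z,z)=1$ for all $z$, $\deg g_\Gamma(z,z')<(\rho(z')-\rho(z))/2$ for $z<z'$, and $g_\Gamma^{\mathrm{rev}}=g_\Gamma\cdot\kappa$. Write $g(Q)=g_\Gamma(\emptyset,Q)$ and, for a face $E$ of $Q$, $g(Q/E)=g_\Gamma(E,Q)$, the $g$-polynomial of the quotient polytope $Q/E$, whose face lattice is $[E,Q]$.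 For a face $F$ of $Q$, Braden and MacPherson's relative $g$-polynomial $g(Q,F)$ is defined recursively by $$\sum_{F\subseteq E\subseteq Q} g(E,F)\,g(Q/E)=g(Q),$$ the sum being over faces $E$ of $Q$. Let $F$ be a nonempty face of $Q$. Put $Y=\{G\in\Gamma: F\subseteq G\}$, $X=\Gamma\smallsetminus Y$, $\rho_X=\rho|_X$, $\rho_Y=\rho|_Y-1$, and $\sigma:X\to Y$, $\sigma(G)=G\vee F$. Let $h_\sigma,\ell_\sigma\in I(\Gamma)$ be given by $(t-1)\cdot h_\sigma=g_\Gamma\cdot\kappa|_{(X/Y)^\circ}$ and $\ell_\sigma=h_\sigma\cdot g_\Gamma^{-1}$, where $\kappa|_{(X/Y)^\circ}$ agrees with $\kappa$ on the intervals $[x,\sigma(x)]$, $x\in X$, and is zero on all others. The local $h$-polynomial of $\sigma$ is $\ell_\sigma(\hat 0_X,\hat 1_Y)=\ell_\sigma(\emptyset,Q)$. For $a=\sum_{i=0}^m a_it^i\in\mathbb Z[t]$ with $a_i=a_{m-i}$ for $0\le i\le m$, put $\Delta a=a_0+\sum_{1\le i\le m/2}(a_i-a_{i-1})t^i$. Statement.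 Let $Q$ be a polytope in a real vector space and let $F$ be a nonempty face of $Q$. Then $\Gamma$ is Eulerian with rank function $\rho$; the map $\sigma$ is a strong formal subdivision between the lower Eulerian posets $X$ and $Y$ with rank functions $\rho_X$ and $\rho_Y$, that is, $\sigma$ is order-preserving and surjective, $\rho_X(x)\le\rho_Y(\sigma(x))$ for all $x\in X$, and whenever $x\in X$, $y\in Y$ and $\sigma(x)\le y$, there is $x'\ge x$ in $X$ with $\rho_X(x')=\rho_Y(y)$ and $\sigma(x')=y$, and $\sum_{x\le x'\in X,\ \sigma(x')=y}(-1)^{\rho_Y(y)-\rho_X(x')}=1$; the elements $g_\Gamma$, $h_\sigma$, $\ell_\sigma$ above exist and are unique; $\ell_\sigma(\hat 0_X,\hat 1_Y)$ is symmetric with $m=\dim Q$; and $$g(Q,F)=\Delta\,\ell_\sigma(\hat 0_X,\hat 1_Y).$$ Moreover, the coefficients of $g(Q,F)$ are all nonnegative if and only if the coefficients of $\ell_\sigma(\hat 0_X,\hat 1_Y)$ are nonnegative and unimodal. -/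

import Mathlib

open Polynomial

/-! ### Finite posets, rank functions, strong formal subdivisions -/

/-- `ρ` is a rank function: it increases by one along every covering relation. -/
def IsRankFunction {B : Type*} [PartialOrder B] (ρ : B → ℤ) : Prop :=
  ∀ z z' : B, z ⋖ z' → ρ z' = ρ z + 1

/-- The finite poset `B` is lower Eulerian, with rank function `ρ`. -/
structure IsLowerEulerian {B : Type*} [PartialOrder B] [LocallyFiniteOrder B]
    (ρ : B → ℤ) : Prop where
  finite : Finite B
  isRankFunction : IsRankFunction ρ
  exists_isLeast : ∃ z₀ : B, ∀ z : B, z₀ ≤ z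
  alternating : ∀ z z' : B, z < z' →
    ∑ z'' ∈ Finset.Icc z z', (((ρ z'').negOnePow : ℤˣ) : ℤ) = 0

open Classical in
/-- `σ : X → Y` is a strong formal subdivision between lower Eulerian posets `X` and `Y` with
rank functions `ρX` and `ρY`. -/
structure IsStrongFormalSubdivision {X Y : Type*} [PartialOrder X] [PartialOrder Y]
    [Fintype X] [LocallyFiniteOrder X] [LocallyFiniteOrder Y]
    (ρX : X → ℤ) (ρY : Y → ℤ) (σ : X → Y) : Prop where
  source : IsLowerEulerian ρX
  target : IsLowerEulerian ρY
  monotone : Monotone σ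
  rank_increasing : ∀ x, ρX x ≤ ρY (σ x)
  surjective : Function.Surjective σ
  strongly_surjective : ∀ x y, σ x ≤ y → ∃ x', x ≤ x' ∧ ρX x' = ρY y ∧ σ x' = y
  sum_eq_one : ∀ x y, σ x ≤ y →
    ∑ x' : X with x ≤ x' ∧ σ x' = y, (((ρY y - ρX x').negOnePow : ℤˣ) : ℤ) = 1

/-- For an element `q` of `Γ`, the map `σ : X → Y`, `σ x = x ⊔ q`, where
`Y = {z | q ≤ z}` and `X = Γ \ Y`. -/
def subdivisionMap {Γ : Type*} [Lattice Γ] (q : Γ) :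
    {z : Γ // ¬ q ≤ z} → {z : Γ // q ≤ z} :=
  fun x => ⟨x.1 ⊔ q, le_sup_right⟩

/-- The rank function on `X = {z | ¬ q ≤ z}` induced by a rank function on `Γ`. -/
def sourceRank {Γ : Type*} [Lattice Γ] (ρ : Γ → ℤ) (q : Γ) : {z : Γ // ¬ q ≤ z} → ℤ :=
  fun x => ρ x.1

/-- The rank function on `Y = {z | q ≤ z}` induced by a rank function on `Γ`, shifted by `-1`. -/
def targetRank {Γ : Type*} [Lattice Γ] (ρ : Γ → ℤ) (q : Γ) : {z : Γ // q ≤ z} → ℤ :=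
  fun y => ρ y.1 - 1

/-! ### Kazhdan–Lusztig–Stanley functions -/

namespace KLS

/-- The natural weak rank function `ρ(z, z') = ρ z' - ρ z`, used for `z ≤ z'` only. -/
def wr {B : Type*} (ρ : B → ℤ) (z z' : B) : ℕ := (ρ z' - ρ z).toNat

/-- The Eulerian kernel `κ(z, z') = (t - 1) ^ ρ(z, z')`. -/
noncomputable def eulerianKernel {B : Type*} [PartialOrder B] (ρ : B → ℤ) :
    IncidenceAlgebra ℤ[X] B :=
  open Classical in
  { toFun := fun z z' => if z ≤ z' then (X - 1) ^ wr ρ z z' else 0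
    eq_zero_of_not_le' := fun _ _ h => if_neg h }

/-- `p^rev(z, z'; t) = t ^ ρ(z, z') * p(z, z'; t⁻¹)`, meaningful if `deg p(z, z') ≤ ρ(z, z')`. -/
noncomputable def rev {B : Type*} [PartialOrder B] (ρ : B → ℤ) (p : IncidenceAlgebra ℤ[X] B) :
    IncidenceAlgebra ℤ[X] B where
  toFun := fun z z' => (p z z').reflect (wr ρ z z')
  eq_zero_of_not_le' := fun z z' h => by
    rw [IncidenceAlgebra.apply_eq_zero_of_not_le h, reflect_zero]

/-- `g` is a left Kazhdan–Lusztig–Stanley function for the kernel `κ`: one has `g(z, z) = 1`,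
`deg g(z, z') < ρ(z, z') / 2` for `z < z'`, and `g^rev = g * κ`. -/
structure IsLeftKLS {B : Type*} [PartialOrder B] [LocallyFiniteOrder B] (ρ : B → ℤ)
    (κ g : IncidenceAlgebra ℤ[X] B) : Prop where
  apply_self : ∀ z, g z z = 1
  degree_lt : ∀ z z', z < z' → 2 * (g z z').natDegree < wr ρ z z'
  rev_eq : rev ρ g = g * κ

open Classical in
/-- The left Kazhdan–Lusztig–Stanley function `g_B` of `B` with its Eulerian kernel
(the value `0` is used only if there is none, i.e. never for lower Eulerian posets). -/
noncomputable def leftKLS {B : Type*} [PartialOrder B] [LocallyFiniteOrder B] (ρ : B → ℤ) :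
    IncidenceAlgebra ℤ[X] B :=
  if h : ∃ g, IsLeftKLS ρ (eulerianKernel ρ) g then h.choose else 0

/-- The restriction `κ|_{(X/Y)°}` of the Eulerian kernel of `Γ` to the intervals `[z, σ z]`
with `z ∈ X`, where `σ : X → Y` is attached to `q`. -/
noncomputable def kernelAlong {Γ : Type*} [Lattice Γ] (ρ : Γ → ℤ) (q : Γ) :
    IncidenceAlgebra ℤ[X] Γ :=
  open Classical in
  { toFun := fun z z' =>
      if ∃ hz : ¬ q ≤ z, z' = (subdivisionMap q ⟨z, hz⟩).1 then eulerianKernel ρ z z' else 0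
    eq_zero_of_not_le' := fun _ _ h => by
      rw [IncidenceAlgebra.apply_eq_zero_of_not_le h, ite_self] }

/-- The `h`-polynomials: `(t - 1) * h_σ = g_Γ * κ|_{(X/Y)°}`, the quotient by the monic
polynomial `t - 1` being taken on every interval. -/
noncomputable def hPoly {Γ : Type*} [Lattice Γ] [LocallyFiniteOrder Γ] (ρ : Γ → ℤ) (q : Γ) :
    IncidenceAlgebra ℤ[X] Γ where
  toFun := fun z z' => (leftKLS ρ * kernelAlong ρ q) z z' /ₘ (X - 1)
  eq_zero_of_not_le' := fun z z' h => by
    rw [IncidenceAlgebra.apply_eq_zero_of_not_le h, zero_divByMonic]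

/-- The local `h`-polynomials: `ℓ_σ = h_σ * g_Γ⁻¹`. -/
noncomputable def localH {Γ : Type*} [Lattice Γ] [LocallyFiniteOrder Γ] [DecidableEq Γ]
    (ρ : Γ → ℤ) (q : Γ) : IncidenceAlgebra ℤ[X] Γ :=
  hPoly ρ q * Ring.inverse (leftKLS ρ)

/-- `a = ∑_{i ≤ m} a_i t^i` with `a_i = a_{m - i}`. -/
def IsSymmetric (m : ℕ) (a : ℤ[X]) : Prop :=
  a.natDegree ≤ m ∧ ∀ i ≤ m, a.coeff i = a.coeff (m - i)

/-- `Δ a = a_0 + ∑_{1 ≤ i ≤ m / 2} (a_i - a_{i-1}) t^i` for a polynomial `a` that is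
symmetric with respect to `m`. -/
noncomputable def delta (m : ℕ) (a : ℤ[X]) : ℤ[X] :=
  C (a.coeff 0) + ∑ i ∈ Finset.Icc 1 (m / 2), C (a.coeff i - a.coeff (i - 1)) * X ^ i

/-- All coefficients are nonnegative. -/
def Nonneg (a : ℤ[X]) : Prop := ∀ i, 0 ≤ a.coeff i

/-- The coefficients weakly increase up to some index and weakly decrease from there on. -/
def Unimodal (a : ℤ[X]) : Prop :=
  ∃ k, (∀ i j, i ≤ j → j ≤ k → a.coeff i ≤ a.coeff j) ∧
    (∀ i j, k ≤ i → i ≤ j → a.coeff j ≤ a.coeff i)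

end KLS

/-! ### Polytopes and their face lattices -/

/-- A polytope in a real vector space: the convex hull of a finite set (possibly empty). -/
structure Polytope (V : Type*) [AddCommGroup V] [Module ℝ V] where
  carrier : Set V
  exists_finset : ∃ s : Finset V, carrier = convexHull ℝ (s : Set V)

namespace Polytope

variable {V : Type*} [AddCommGroup V] [Module ℝ V]

/-- `G` is a face of `P`: it is cut out by a linear inequality valid on `P`. This includes
`∅` and `P` itself. -/
def IsFace (P : Polytope V) (G : Set V) : Prop :=
  ∃ (l : V →ₗ[ℝ] ℝ) (c : ℝ), (∀ x ∈ P.carrier, l x ≤ c) ∧ G = {x ∈ P.carrier | l x = c}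

theorem IsFace.subset {P : Polytope V} {G : Set V} (h : P.IsFace G) : G ⊆ P.carrier := by
  obtain ⟨l, c, -, rfl⟩ := h
  exact fun x hx => hx.1

theorem isFace_self (P : Polytope V) : P.IsFace P.carrier :=
  ⟨0, 0, by simp, by simp⟩

theorem isFace_empty (P : Polytope V) : P.IsFace ∅ :=
  ⟨0, 1, by simp, by simp⟩

theorem IsFace.inter {P : Polytope V} {G H : Set V} (hG : P.IsFace G) (hH : P.IsFace H) :
    P.IsFace (G ∩ H) := by
  obtain ⟨l, c, hl, rfl⟩ := hG
  obtain ⟨m, d, hm, rfl⟩ := hH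
  refine ⟨l + m, c + d, fun x hx => add_le_add (hl x hx) (hm x hx), ?_⟩
  ext x
  simp only [Set.mem_inter_iff, Set.mem_ofPred_eq, LinearMap.add_apply]
  constructor
  · rintro ⟨⟨hx, h1⟩, -, h2⟩
    exact ⟨hx, by rw [h1, h2]⟩
  · rintro ⟨hx, h⟩
    have h1 := hl x hx
    have h2 := hm x hx
    exact ⟨⟨hx, by linarith⟩, hx, by linarith⟩

open Classical in
theorem IsFace.eq_convexHull {P : Polytope V} {G : Set V} (h : P.IsFace G) {s : Finset V}
    (hs : P.carrier = convexHull ℝ (s : Set V)) :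
    G = convexHull ℝ ((s.filter (· ∈ G) : Finset V) : Set V) := by
  obtain ⟨l, c, hl, hG⟩ := h
  have hmem : ∀ y, y ∈ G ↔ y ∈ P.carrier ∧ l y = c := fun y => by rw [hG]; rfl
  clear hG
  have hsP : ∀ y ∈ s, y ∈ P.carrier := fun y hy => hs ▸ subset_convexHull ℝ _ hy
  apply Set.Subset.antisymm
  · intro x hxG
    obtain ⟨hx, hxc⟩ := (hmem x).1 hxG
    rw [hs, Finset.mem_convexHull'] at hx
    obtain ⟨w, hw0, hw1, rfl⟩ := hx
    have key : ∀ y ∈ s, w y * (c - l y) = 0 := by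
      have hsum : ∑ y ∈ s, w y * (c - l y) = 0 := by
        simp only [mul_sub, Finset.sum_sub_distrib, ← Finset.sum_mul, hw1, one_mul]
        simp only [map_sum, map_smul, smul_eq_mul] at hxc
        rw [hxc, sub_self]
      exact (Finset.sum_eq_zero_iff_of_nonneg fun y hy =>
        mul_nonneg (hw0 y hy) (sub_nonneg.2 (hl y (hsP y hy)))).1 hsum
    have hz : ∀ y ∈ s, y ∉ G → w y = 0 := by
      intro y hy hn
      rcases mul_eq_zero.1 (key y hy) with h | h
      · exact h
      · exact absurd ((hmem y).2 ⟨hsP y hy, by linarith⟩) hn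
    rw [Finset.mem_convexHull']
    refine ⟨w, fun y hy => hw0 y (Finset.mem_filter.1 hy).1, ?_, ?_⟩
    · rw [← hw1]
      refine Finset.sum_subset (Finset.filter_subset _ _) fun y hy hn => hz y hy ?_
      exact fun h => hn (Finset.mem_filter.2 ⟨hy, h⟩)
    · refine Finset.sum_subset (Finset.filter_subset _ _) fun y hy hn => ?_
      rw [hz y hy fun h => hn (Finset.mem_filter.2 ⟨hy, h⟩), zero_smul]
  · refine convexHull_min (fun y hy => (Finset.mem_filter.1 hy).2) ?_
    intro x hx y hy a b ha hb hab
    obtain ⟨hx1, hx2⟩ := (hmem x).1 hx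
    obtain ⟨hy1, hy2⟩ := (hmem y).1 hy
    refine (hmem _).2 ⟨?_, ?_⟩
    · have hc : Convex ℝ P.carrier := hs ▸ convex_convexHull ℝ _
      exact hc hx1 hy1 ha hb hab
    · simp only [map_add, map_smul, smul_eq_mul, hx2, hy2, ← add_mul, hab, one_mul]

/-- The set of faces of `P`, including `∅` and `P`. -/
def Face (P : Polytope V) : Type _ := {G : Set V // P.IsFace G}

namespace Face

variable {P : Polytope V}

/-- The underlying set of a face. -/
def carrier (G : Face P) : Set V := G.1

/-- Faces are ordered by inclusion. -/
instance : PartialOrder (Face P) := inferInstanceAs (PartialOrder {G : Set V // P.IsFace G})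

theorem le_def {G H : Face P} : G ≤ H ↔ G.carrier ⊆ H.carrier := Iff.rfl

instance : Finite (Face P) := by
  classical
  obtain ⟨s, hs⟩ := P.exists_finset
  refine Finite.of_injective
    (fun G : Face P => (⟨s.filter (· ∈ G.1), Finset.mem_powerset.2 (Finset.filter_subset _ _)⟩ :
      {t : Finset V // t ∈ s.powerset})) ?_
  intro G H h
  have h' : s.filter (· ∈ G.1) = s.filter (· ∈ H.1) := congrArg Subtype.val h
  apply Subtype.ext
  rw [G.2.eq_convexHull hs, H.2.eq_convexHull hs, h']

theorem isFace_inter_biInter (S : Set (Face P)) :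
    P.IsFace (P.carrier ∩ ⋂ G ∈ S, G.carrier) := by
  induction S, S.toFinite using Set.Finite.induction_on with
  | empty => simpa using P.isFace_self
  | @insert G S _ _ ih =>
    have : P.carrier ∩ ⋂ H ∈ insert G S, H.carrier
        = G.carrier ∩ (P.carrier ∩ ⋂ H ∈ S, H.carrier) := by
      rw [Set.biInter_insert]
      exact Set.inter_left_comm _ _ _
    rw [this]
    exact IsFace.inter G.2 ih

/-- The infimum of a set of faces is their intersection (inside `P`). -/
instance : InfSet (Face P) := ⟨fun S => ⟨P.carrier ∩ ⋂ G ∈ S, G.carrier, isFace_inter_biInter S⟩⟩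

theorem isGLB_sInf (S : Set (Face P)) : IsGLB S (sInf S) := by
  constructor
  · intro G hG x hx
    exact Set.mem_iInter₂.1 hx.2 G hG
  · intro G hG x hx
    exact ⟨G.2.subset hx, Set.mem_iInter₂.2 fun H hH => hG hH hx⟩

/-- The face lattice of `P`, with `⊥ = ∅` and `⊤ = P`. -/
instance : CompleteLattice (Face P) where
  __ := completeLatticeOfInf (Face P) isGLB_sInf
  bot := ⟨∅, P.isFace_empty⟩
  bot_le := fun _ => Set.empty_subset _
  top := ⟨P.carrier, P.isFace_self⟩
  le_top := fun G => G.2.subset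

noncomputable instance : Fintype (Face P) := Fintype.ofFinite _

noncomputable instance : DecidableEq (Face P) := Classical.decEq _

noncomputable instance : DecidableLE (Face P) := Classical.decRel _

noncomputable instance : DecidableLT (Face P) := Classical.decRel _

noncomputable instance : LocallyFiniteOrder (Face P) := Fintype.toLocallyFiniteOrder

/-- A face of a polytope, as a polytope. -/
def toPolytope (G : Face P) : Polytope V where
  carrier := G.carrier
  exists_finset := by
    classical
    obtain ⟨s, hs⟩ := P.exists_finset
    exact ⟨_, G.2.eq_convexHull hs⟩

/-- A face of `P` contained in a face `G` of `P` is a face of the polytope `G`. -/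
def restrict (F G : Face P) (h : F ≤ G) : Face G.toPolytope :=
  ⟨F.carrier, by
    obtain ⟨l, c, hl, hF⟩ := F.2
    refine ⟨l, c, fun x hx => hl x (G.2.subset hx), ?_⟩
    ext x
    constructor
    · intro hx
      have hx' : x ∈ F.1 := hx
      rw [hF] at hx'
      exact ⟨h hx, hx'.2⟩
    · rintro ⟨hx, hxc⟩
      change x ∈ F.1
      rw [hF]
      exact ⟨G.2.subset hx, hxc⟩⟩

end Face

/-- The dimension of a nonempty polytope (the value at the empty polytope is `0`). -/
noncomputable def dim (P : Polytope V) : ℕ := Module.finrank ℝ (vectorSpan ℝ P.carrier)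

open Classical in
/-- `dim P + 1`, where the empty polytope has dimension `-1`. -/
noncomputable def dimSucc (P : Polytope V) : ℕ := if P.carrier = ∅ then 0 else P.dim + 1

/-- The natural rank function `G ↦ dim G + 1` of the face lattice. -/
noncomputable def rank (P : Polytope V) (G : Face P) : ℤ := (G.toPolytope.dimSucc : ℤ)

theorem dimSucc_lt {P : Polytope V} (G : Face P) (hG : G < ⊤) :
    G.toPolytope.dimSucc < P.dimSucc := by
  classical
  obtain ⟨l, c, hl, hGe⟩ := G.2
  have hGe' : G.toPolytope.carrier = {x ∈ P.carrier | l x = c} := hGe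
  obtain ⟨x, hxP, hxG⟩ : ∃ x ∈ P.carrier, x ∉ G.carrier := by
    by_contra! hcon
    exact hG.not_ge hcon
  have hPne : P.carrier ≠ ∅ := fun h => by simp [h] at hxP
  unfold dimSucc
  rw [if_neg hPne]
  by_cases hE : G.toPolytope.carrier = ∅
  · rw [if_pos hE]; omega
  rw [if_neg hE]
  obtain ⟨e, he⟩ := Set.nonempty_iff_ne_empty.2 hE
  have hfin : FiniteDimensional ℝ (vectorSpan ℝ P.carrier) := by
    obtain ⟨s, hs⟩ := P.exists_finset
    rw [hs, ← direction_affineSpan, affineSpan_convexHull, direction_affineSpan]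
    exact finiteDimensional_vectorSpan_of_finite ℝ s.finite_toSet
  have hsub : G.toPolytope.carrier ⊆ P.carrier := G.2.subset
  have hle : vectorSpan ℝ G.toPolytope.carrier ≤ vectorSpan ℝ P.carrier := vectorSpan_mono ℝ hsub
  have hker : vectorSpan ℝ G.toPolytope.carrier ≤ LinearMap.ker l := by
    rw [vectorSpan_def, Submodule.span_le]
    rintro _ ⟨a, ha, b, hb, rfl⟩
    rw [hGe'] at ha hb
    simp [ha.2, hb.2]
  have hlt : vectorSpan ℝ G.toPolytope.carrier < vectorSpan ℝ P.carrier := by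
    refine lt_of_le_of_ne hle fun heq => hxG ?_
    have hmem : x -ᵥ e ∈ vectorSpan ℝ P.carrier := vsub_mem_vectorSpan ℝ hxP (hsub he)
    rw [← heq] at hmem
    have h0 := hker hmem
    rw [hGe'] at he
    rw [LinearMap.mem_ker, vsub_eq_sub, map_sub, he.2, sub_eq_zero] at h0
    change x ∈ G.1
    rw [hGe]
    exact ⟨hxP, h0⟩
  have := Submodule.finrank_lt_finrank_of_lt hlt
  unfold dim
  omega

/-- The `g`-polynomial of the polytope `P`. -/
noncomputable def g (P : Polytope V) : ℤ[X] := KLS.leftKLS P.rank ⊥ ⊤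

/-- The `g`-polynomial of the quotient polytope `P/E`, whose face lattice is the
interval `[E, P]` of the face lattice of `P`. -/
noncomputable def gQuotient (P : Polytope V) (E : Face P) : ℤ[X] := KLS.leftKLS P.rank E ⊤

open Classical in
/-- The relative `g`-polynomial `g(P, F)`, defined recursively by
`∑_{F ⊆ E ⊆ P} g(E, F) * g(P/E) = g(P)`, the sum being over faces `E` of `P`; the term
`E = P` is `g(P, F)`. -/
noncomputable def relativeG (P : Polytope V) (F : Face P) : ℤ[X] :=
  P.g - ∑ E : {E : Face P // F ≤ E ∧ E < ⊤},
    relativeG E.1.toPolytope (F.restrict E.1 E.2.1) * P.gQuotient E.1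
termination_by P.dimSucc
decreasing_by exact dimSucc_lt E.1 E.2.2

end Polytope

/-! The proof has a geometric half and an algebraic half.

Geometry shows that the face lattice is Eulerian. Let $Q$ be the hull of a finite set `s`. Faces are
the zero sets on $Q$ of affine functionals that are nonnegative on $Q$, so they correspond, with
inclusion reversed, to the faces of a polyhedral cone of functionals. An interval $[G,H]$
corresponds to the cone of functionals that vanish on $G$ and are nonnegative at the points of `s`
in $H$. Alternating sums over intervals thus become Euler relations for cones
(`sum_neg_one_pow_finrank_flat`). These follow by induction on dimension: slice the cone by a pencil
of hyperplanes and integrate over the parameter with respect to Euler characteristic.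

The algebra works in any lower Eulerian lattice with an element $q$. Weisner's theorem
(`sum_sup_eq`) shows that $\sigma$ is a strong formal subdivision and, writing $\kappa_\sigma$ for
`kernelAlong`, that $\kappa\,\kappa_\sigma^{rev}=-\kappa_\sigma\kappa$. Put $L=(t-1)\ell_\sigma$, so
$Lg=g\kappa_\sigma$. Reversal gives
$L^{rev}g\kappa=g\kappa\kappa_\sigma^{rev}=-g\kappa_\sigma\kappa=-Lg\kappa$, hence $L^{rev}=-L$,
which is the symmetry of $\ell_\sigma$. Let $D$ be the part of $-L$ below half degree; its entries
are the $\Delta\ell_\sigma$, and $D^{rev}=D+L$. Uniqueness of low-degree solutions of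
$d^{rev}=d\kappa$ then yields $Dg=g$ on intervals from $x\not\ge q$ to $y\ge q$
(`deltaLocalH_mul_leftKLS`). For $x=\emptyset$ and $q=F$ this is the recursion defining $g(E,F)$, so
$D(\emptyset,E)=g(E,F)$ for every face $E\supseteq F$. The last claim holds because $\Delta$ lists
the increments of a symmetric sequence up to its middle. -/

/-! ### The Euler relation for polyhedral cones -/

namespace ConeCells

variable {ι W : Type*} [AddCommGroup W] [Module ℝ W]

/-- The vector `w` is positive on the functionals in `U` and zero on those in `J \ U`. -/
def InCell (a : ι → W →ₗ[ℝ] ℝ) (J U : Finset ι) (w : W) : Prop :=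
  ∀ i ∈ J, (i ∈ U → 0 < a i w) ∧ (i ∉ U → a i w = 0)

open Classical in
/-- The supports of the vectors in the cone `{w ∈ P | ∀ i ∈ J, 0 ≤ a i w}`; they correspond to
its faces. -/
noncomputable def cells (a : ι → W →ₗ[ℝ] ℝ) (P : Submodule ℝ W) (J : Finset ι) :
    Finset (Finset ι) :=
  J.powerset.filter fun U => ∃ w ∈ P, InCell a J U w

/-- The linear span of the cell `U`. -/
def flat (a : ι → W →ₗ[ℝ] ℝ) (P : Submodule ℝ W) (J U : Finset ι) : Submodule ℝ W where
  carrier := {w | w ∈ P ∧ ∀ i ∈ J, i ∉ U → a i w = 0}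
  zero_mem' := ⟨P.zero_mem, fun _ _ _ => map_zero _⟩
  add_mem' := fun hx hy => ⟨P.add_mem hx.1 hy.1, fun i hi hU => by
    rw [map_add, hx.2 i hi hU, hy.2 i hi hU, add_zero]⟩
  smul_mem' := fun c _ hx => ⟨P.smul_mem c hx.1, fun i hi hU => by
    rw [map_smul, hx.2 i hi hU, smul_zero]⟩

variable {a : ι → W →ₗ[ℝ] ℝ} {P : Submodule ℝ W} {J U : Finset ι}

theorem mem_flat {w : W} : w ∈ flat a P J U ↔ w ∈ P ∧ ∀ i ∈ J, i ∉ U → a i w = 0 := Iff.rfl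

theorem mem_cells : U ∈ cells a P J ↔ U ⊆ J ∧ ∃ w ∈ P, InCell a J U w := by
  simp [cells]

theorem InCell.mem_flat {w : W} (h : InCell a J U w) (hw : w ∈ P) : w ∈ flat a P J U :=
  ⟨hw, fun i hi => (h i hi).2⟩

theorem InCell.nonneg {w : W} (h : InCell a J U w) {i : ι} (hi : i ∈ J) : 0 ≤ a i w := by
  by_cases hU : i ∈ U
  · exact ((h i hi).1 hU).le
  · exact ((h i hi).2 hU).ge

theorem InCell.mem_iff {w : W} (h : InCell a J U w) {i : ι} (hi : i ∈ J) :
    i ∈ U ↔ 0 < a i w := by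
  refine ⟨(h i hi).1, fun hp => ?_⟩
  by_contra hU
  exact hp.ne' ((h i hi).2 hU)

theorem empty_mem_cells : ∅ ∈ cells a P J :=
  mem_cells.2 ⟨Finset.empty_subset _, 0, P.zero_mem, fun i _ => by simp⟩

theorem exists_inCell_of_nonneg {w : W} (hw : w ∈ P) (h : ∀ i ∈ J, 0 ≤ a i w) :
    ∃ V ∈ cells a P J, InCell a J V w := by
  classical
  have hc : InCell a J (J.filter fun i => 0 < a i w) w := by
    intro i hi
    simp only [Finset.mem_filter, hi, true_and, imp_self, not_lt]
    exact fun h' => le_antisymm h' (h i hi)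
  exact ⟨_, mem_cells.2 ⟨Finset.filter_subset _ _, w, hw, hc⟩, hc⟩

/-- Moving from `w` in the direction `u` until the boundary of the cone is reached. -/
theorem exists_first_zero {w u : W} (hw : InCell a J U w) {i₀ : ι}
    (hi₀ : i₀ ∈ J) (hneg : a i₀ u < 0) :
    ∃ s : ℝ, (∀ i ∈ J, 0 ≤ a i (w + s • u)) ∧ ∃ i ∈ J, a i (w + s • u) = 0 ∧ a i u < 0 := by
  classical
  obtain ⟨i, hi, hmin⟩ := (J.filter fun i => a i u < 0).exists_min_image
    (fun i => a i w / (-a i u)) ⟨i₀, Finset.mem_filter.2 ⟨hi₀, hneg⟩⟩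
  obtain ⟨hiJ, hin⟩ := Finset.mem_filter.1 hi
  have hs0 : 0 ≤ a i w / (-a i u) := div_nonneg (hw.nonneg hiJ) (by linarith)
  refine ⟨a i w / (-a i u), fun k hk => ?_, i, hiJ, ?_, hin⟩
  · rw [map_add, map_smul, smul_eq_mul]
    rcases lt_or_ge (a k u) 0 with hku | hku
    · have := hmin k (Finset.mem_filter.2 ⟨hk, hku⟩)
      rw [le_div_iff₀ (by linarith)] at this
      linarith
    · exact add_nonneg (hw.nonneg hk) (mul_nonneg hs0 hku)
  · rw [map_add, map_smul, smul_eq_mul]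
    rw [div_neg, neg_mul, div_mul_cancel₀ _ hin.ne, add_neg_cancel]

theorem InCell.eventually {w u : W} (hw : InCell a J U w) (hu : ∀ i ∈ J, i ∉ U → a i u = 0) :
    ∀ᶠ r in nhds (0 : ℝ), InCell a J U (w + r • u) := by
  refine (Filter.eventually_all_finset J).2 fun i hi => ?_
  by_cases hU : i ∈ U
  · have hc : Continuous fun r : ℝ => a i w + r * a i u := by fun_prop
    have h0 : 0 < a i w + 0 * a i u := by simpa using (hw i hi).1 hU
    filter_upwards [hc.continuousAt.eventually (lt_mem_nhds h0)] with r hr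
    exact ⟨fun _ => by simpa using hr, fun h => absurd hU h⟩
  · exact Filter.Eventually.of_forall fun r =>
      ⟨fun h => absurd h hU, fun _ => by simp [(hw i hi).2 hU, hu i hi hU]⟩

theorem finrank_inf_ker_add_one {K M : Type*} [Field K] [AddCommGroup M] [Module K M]
    (P : Submodule K M) [FiniteDimensional K P] (f : M →ₗ[K] K) (h : ∃ w ∈ P, f w ≠ 0) :
    Module.finrank K (P ⊓ LinearMap.ker f : Submodule K M) + 1 = Module.finrank K P := by
  obtain ⟨w, hw, hf⟩ := h
  have h1 := LinearMap.finrank_range_add_finrank_ker (f.domRestrict P)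
  have h2 : LinearMap.range (f.domRestrict P) = ⊤ := by
    rw [LinearMap.range_eq_top]
    exact LinearMap.surjective (fun h0 => hf (by simpa using LinearMap.congr_fun h0 ⟨w, hw⟩))
  have h3 : (LinearMap.ker (f.domRestrict P)).map P.subtype = P ⊓ LinearMap.ker f := by
    ext x
    simp [and_comm]
  rw [h2, finrank_top, Module.finrank_self] at h1
  rw [← h3, Submodule.finrank_map_subtype_eq, ← h1, add_comm]

/-- If the cone has only one cell besides its lineality space, it is a half-space of its span. -/
theorem finrank_flat_of_cells_subset [FiniteDimensional ℝ W] {U₀ : Finset ι}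
    (h : ∀ U ∈ cells a P J, U = ∅ ∨ U = U₀)
    (hU₀ : U₀ ∈ cells a P J) (hne : U₀.Nonempty) :
    Module.finrank ℝ (flat a P J U₀) = Module.finrank ℝ (flat a P J ∅) + 1 := by
  obtain ⟨hsub, w, hw, hc⟩ := mem_cells.1 hU₀
  obtain ⟨i₀, hi₀⟩ := hne
  -- Otherwise one could walk from `w` along `u` to the boundary. There `a i₀` is still positive, so
  -- the cell reached is `U₀` again, although a coordinate belonging to a decreasing functional has
  -- become zero.
  have key : ∀ u ∈ flat a P J U₀, a i₀ u = 0 → ∀ i ∈ J, ¬ a i u < 0 := by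
    intro u hu hu0 i hi hneg
    obtain ⟨s, hs, k, hk, hk0, hkn⟩ := exists_first_zero hc hi hneg
    obtain ⟨V, hV, hVc⟩ := exists_inCell_of_nonneg (P.add_mem hw (P.smul_mem s hu.1)) hs
    have hi₀V : i₀ ∈ V := by
      rw [hVc.mem_iff (hsub hi₀), map_add, map_smul, hu0, smul_zero, add_zero]
      exact (hc i₀ (hsub hi₀)).1 hi₀
    rcases h V hV with rfl | rfl
    · simp at hi₀V
    · have hkV : k ∉ V := fun hkV => ((hVc k hk).1 hkV).ne' hk0
      exact hkn.ne (hu.2 k hk hkV)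
  have heq : flat a P J ∅ = flat a P J U₀ ⊓ LinearMap.ker (a i₀) := by
    ext u
    constructor
    · exact fun hu => ⟨⟨hu.1, fun i hi _ => hu.2 i hi (Finset.notMem_empty i)⟩,
        hu.2 i₀ (hsub hi₀) (Finset.notMem_empty i₀)⟩
    · rintro ⟨hu, hu0⟩
      refine ⟨hu.1, fun i hi _ => le_antisymm ?_ (not_lt.1 (key u hu hu0 i hi))⟩
      have := key (-u) (Submodule.neg_mem _ hu) (by simpa using hu0) i hi
      simpa using this
  rw [heq, finrank_inf_ker_add_one _ _ ⟨w, hc.mem_flat hw, ((hc i₀ (hsub hi₀)).1 hi₀).ne'⟩]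

/-- If `V` had an element `p` outside `U`, subtracting multiples of a vector of `U` from one of `V`
until some `a i` vanishes would keep `a p` positive. This point and the vector of `U` would be an
excluded pair. Hence a cone without such pairs has at most one nonempty cell. -/
theorem eq_of_no_incomparable
    (h : ∀ j ∈ J, ∀ k ∈ J, ∀ x ∈ P, ∀ y ∈ P, (∀ i ∈ J, 0 ≤ a i x) → (∀ i ∈ J, 0 ≤ a i y) →
      a j x = 0 → 0 < a k x → a k y = 0 → ¬ 0 < a j y)
    {U V : Finset ι} (hU : U ∈ cells a P J) (hV : V ∈ cells a P J) (hUne : U.Nonempty) :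
    V ⊆ U := by
  obtain ⟨hUJ, w, hw, hwc⟩ := mem_cells.1 hU
  obtain ⟨hVJ, v, hv, hvc⟩ := mem_cells.1 hV
  intro p hpV
  by_contra hpU
  have hpJ := hVJ hpV
  have hvp := (hvc p hpJ).1 hpV
  have hwp := (hwc p hpJ).2 hpU
  have hwn : ∀ i ∈ J, 0 ≤ a i w := fun i hi => hwc.nonneg hi
  obtain ⟨i₀, hi₀⟩ := hUne
  have hi₀p := (hwc i₀ (hUJ hi₀)).1 hi₀
  obtain ⟨s, hs, i, hi, hi0, hin⟩ := exists_first_zero (u := -w) hvc (hUJ hi₀)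
    (by rw [map_neg]; linarith)
  refine h i hi p hpJ (v + s • -w) (P.add_mem hv (P.smul_mem s (P.neg_mem hw))) w hw hs hwn hi0
    ?_ hwp ?_
  · rw [map_add, map_smul, map_neg, hwp, neg_zero, smul_zero, add_zero]
    exact hvp
  · rw [map_neg] at hin
    linarith

/-! #### Integration with respect to the Euler characteristic on an interval -/

theorem exists_pos_forall_add_lt (B : Finset ℝ) : ∃ δ > 0, ∀ p ∈ B, ∀ q ∈ B, p < q → p + δ < q := by
  have : ∀ᶠ δ in nhdsWithin (0 : ℝ) (Set.Ioi 0), ∀ p ∈ B, ∀ q ∈ B, p < q → p + δ < q := by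
    refine (Filter.eventually_all_finset B).2 fun p _ =>
      (Filter.eventually_all_finset B).2 fun q _ => ?_
    by_cases hpq : p < q
    · have : ∀ᶠ δ in nhds (0 : ℝ), δ < q - p := gt_mem_nhds (by linarith)
      filter_upwards [this.filter_mono nhdsWithin_le_nhds] with δ hδ _
      linarith
    · exact Filter.Eventually.of_forall fun _ h => absurd h hpq
  obtain ⟨δ, hδ, h⟩ := (this.and self_mem_nhdsWithin).exists
  exact ⟨δ, h, hδ⟩

open Classical in
/-- The jump functional `∑ (f b - f (b + δ))` is `1` on closed and `-1` on open intervals. -/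
theorem sum_sub_indicator_Icc {I : Set ℝ} {B : Finset ℝ} {δ : ℝ} (hδ : 0 < δ)
    (h : ∀ p ∈ B, ∀ q ∈ B, p < q → p + δ < q) {α β : ℝ} (hα : α ∈ B) (hβ : β ∈ B) (hαβ : α ≤ β)
    (hI : I = Set.Icc α β) :
    ∑ b ∈ B, ((if b ∈ I then 1 else 0 : ℤ) - if b + δ ∈ I then 1 else 0)
      = 1 := by
  subst hI
  -- As `δ` is smaller than every gap of `B`, the points `p` and `p + δ` lie on the same side of
  -- each endpoint, except that the shift leaves the interval at `p = β`.
  rw [Finset.sum_eq_single β]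
  · rw [if_pos ⟨hαβ, le_rfl⟩, if_neg (fun h' => by have := h'.2; linarith), sub_zero]
  · intro p hp hpβ
    have : p ∈ Set.Icc α β ↔ p + δ ∈ Set.Icc α β := by
      constructor
      · rintro ⟨h1, h2⟩
        exact ⟨by linarith, (h p hp β hβ (lt_of_le_of_ne h2 hpβ)).le⟩
      · rintro ⟨h1, h2⟩
        refine ⟨?_, by linarith⟩
        by_contra hlt
        have := h p hp α hα (not_le.1 hlt)
        linarith
    by_cases hq : p + δ ∈ Set.Icc α β
    · rw [if_pos hq, if_pos (this.2 hq), sub_self]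
    · rw [if_neg hq, if_neg fun h' => hq (this.1 h'), sub_self]
  · exact fun h' => absurd hβ h'

open Classical in
theorem sum_sub_indicator_Ioo {I : Set ℝ} {B : Finset ℝ} {δ : ℝ} (hδ : 0 < δ)
    (h : ∀ p ∈ B, ∀ q ∈ B, p < q → p + δ < q) {α β : ℝ} (hα : α ∈ B) (hβ : β ∈ B) (hαβ : α < β)
    (hI : I = Set.Ioo α β) :
    ∑ b ∈ B, ((if b ∈ I then 1 else 0 : ℤ) - if b + δ ∈ I then 1 else 0)
      = -1 := by
  subst hI
  -- Here only the left endpoint jumps: the shift enters the open interval at `p = α`, while at `β`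
  -- both points are outside.
  rw [Finset.sum_eq_single α]
  · rw [if_pos (show α + δ ∈ Set.Ioo α β from ⟨by linarith, h α hα β hβ hαβ⟩),
      if_neg (fun h' => lt_irrefl _ h'.1), zero_sub]
  · intro p hp hpα
    have : p ∈ Set.Ioo α β ↔ p + δ ∈ Set.Ioo α β := by
      constructor
      · rintro ⟨h1, h2⟩
        exact ⟨by linarith, h p hp β hβ h2⟩
      · rintro ⟨h1, h2⟩
        refine ⟨?_, by linarith⟩
        by_contra hlt
        have := h p hp α hα (lt_of_le_of_ne (not_lt.1 hlt) hpα)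
        linarith
    by_cases hq : p + δ ∈ Set.Ioo α β
    · rw [if_pos hq, if_pos (this.2 hq), sub_self]
    · rw [if_neg hq, if_neg fun h' => hq (this.1 h'), sub_self]
  · exact fun h' => absurd hα h'

open Classical in
/-- If a combination of indicator functions of closed and open intervals vanishes, then so does
the combination of their Euler characteristics. -/
theorem sum_mul_euler_eq_zero {κ : Type*} (S : Finset κ) (n ε : κ → ℤ) (I : κ → Set ℝ)
    (hI : ∀ u ∈ S, (∃ α β, α ≤ β ∧ I u = Set.Icc α β ∧ ε u = 1) ∨
      ∃ α β, α < β ∧ I u = Set.Ioo α β ∧ ε u = -1)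
    (h : ∀ θ, ∑ u ∈ S, (if θ ∈ I u then n u else 0) = 0) :
    ∑ u ∈ S, n u * ε u = 0 := by
  have hI' : ∀ u, ∃ α β, u ∈ S → (α ≤ β ∧ I u = Set.Icc α β ∧ ε u = 1) ∨
      (α < β ∧ I u = Set.Ioo α β ∧ ε u = -1) := by
    intro u
    by_cases hu : u ∈ S
    · rcases hI u hu with ⟨α, β, h⟩ | ⟨α, β, h⟩
      · exact ⟨α, β, fun _ => .inl h⟩
      · exact ⟨α, β, fun _ => .inr h⟩
    · exact ⟨0, 0, fun h => absurd h hu⟩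
  choose α β hαβ using hI'
  obtain ⟨δ, hδ, hB⟩ := exists_pos_forall_add_lt (S.image α ∪ S.image β)
  have key : ∀ u ∈ S, n u * ε u = ∑ b ∈ S.image α ∪ S.image β,
      ((if b ∈ I u then n u else 0) - if b + δ ∈ I u then n u else 0) := by
    intro u hu
    have hα : α u ∈ S.image α ∪ S.image β :=
      Finset.mem_union_left _ (Finset.mem_image_of_mem _ hu)
    have hβ : β u ∈ S.image α ∪ S.image β :=
      Finset.mem_union_right _ (Finset.mem_image_of_mem _ hu)
    have : ε u = ∑ b ∈ S.image α ∪ S.image β,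
        ((if b ∈ I u then 1 else 0 : ℤ) - if b + δ ∈ I u then 1 else 0) := by
      rcases hαβ u hu with ⟨h1, h2, h3⟩ | ⟨h1, h2, h3⟩
      · rw [h3, sum_sub_indicator_Icc hδ hB hα hβ h1 h2]
      · rw [h3, sum_sub_indicator_Ioo hδ hB hα hβ h1 h2]
    rw [this, Finset.mul_sum]
    refine Finset.sum_congr rfl fun b _ => ?_
    rw [mul_sub, mul_ite, mul_ite, mul_one, mul_zero]
  rw [Finset.sum_congr rfl key, Finset.sum_comm]
  refine Finset.sum_eq_zero fun b _ => ?_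
  rw [Finset.sum_sub_distrib, h, h, sub_zero]

theorem eq_Ioo_of_no_extrema {I : Set ℝ} (hne : I.Nonempty) (hb : I ⊆ Set.Icc 0 1)
    (hmax : ∀ θ ∈ I, ∃ θ' ∈ I, θ < θ') (hmin : ∀ θ ∈ I, ∃ θ' ∈ I, θ' < θ)
    (hconv : ∀ θ₁ ∈ I, ∀ θ₂ ∈ I, ∀ θ, θ₁ < θ → θ < θ₂ → θ ∈ I) :
    ∃ α β, α < β ∧ I = Set.Ioo α β := by
  have hA : BddAbove I := ⟨1, fun θ hθ => (hb hθ).2⟩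
  have hB : BddBelow I := ⟨0, fun θ hθ => (hb hθ).1⟩
  have hI : I = Set.Ioo (sInf I) (sSup I) := by
    ext θ
    constructor
    · intro hθ
      obtain ⟨θ₁, h₁, h₁'⟩ := hmin θ hθ
      obtain ⟨θ₂, h₂, h₂'⟩ := hmax θ hθ
      exact ⟨(csInf_le hB h₁).trans_lt h₁', h₂'.trans_le (le_csSup hA h₂)⟩
    · rintro ⟨h₁, h₂⟩
      obtain ⟨θ₁, h₁, h₁'⟩ := exists_lt_of_csInf_lt hne h₁
      obtain ⟨θ₂, h₂, h₂'⟩ := exists_lt_of_lt_csSup hne h₂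
      exact hconv θ₁ h₁ θ₂ h₂ θ h₁' h₂'
  refine ⟨_, _, ?_, hI⟩
  obtain ⟨θ, hθ⟩ := hne
  rw [hI] at hθ
  exact hθ.1.trans hθ.2

/-! #### The Euler relation -/

/-- A pencil of functionals interpolating between `f` and `-g`. -/
noncomputable def pencil (f g : W →ₗ[ℝ] ℝ) (θ : ℝ) : W →ₗ[ℝ] ℝ := (1 - θ) • f - θ • g

theorem pencil_apply (f g : W →ₗ[ℝ] ℝ) (θ : ℝ) (w : W) :
    pencil f g θ w = f w - θ * (f w + g w) := by
  simp [pencil]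
  ring

theorem InCell.add_smul {w v : W} (hw : InCell a J U w) (hv : InCell a J U v) {r s : ℝ}
    (hr : 0 < r) (hs : 0 < s) : InCell a J U (r • w + s • v) := by
  intro i hi
  simp only [map_add, map_smul, smul_eq_mul]
  refine ⟨fun h => ?_, fun h => ?_⟩
  · exact add_pos (mul_pos hr ((hw i hi).1 h)) (mul_pos hs ((hv i hi).1 h))
  · rw [(hw i hi).2 h, (hv i hi).2 h, mul_zero, mul_zero, add_zero]

/-- The parameters `θ ∈ [0, 1]` whose hyperplane in the pencil meets the cell `U`. -/
def pencilRange (a : ι → W →ₗ[ℝ] ℝ) (P : Submodule ℝ W) (J : Finset ι) (j k : ι)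
    (U : Finset ι) : Set ℝ :=
  {θ | θ ∈ Set.Icc (0 : ℝ) 1 ∧ ∃ w ∈ P, InCell a J U w ∧ pencil (a j) (a k) θ w = 0}

/-- A slice either contains the span of the cell or cuts it transversally. In the first case the
range is all of `[0, 1]` or one point; in the second, moving inside the relatively open cell moves
the parameter both ways, so the range is open. This matches the dimension drop (0 or 1) with the
Euler characteristic (1 or -1) of the range. -/
theorem pencilRange_eq {j k : ι} (hj : j ∈ J) (hk : k ∈ J) (hU : U ∈ cells a P J) :
    (∃ α β, α ≤ β ∧ pencilRange a P J j k U = Set.Icc α β ∧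
      ∀ θ ∈ pencilRange a P J j k U, flat a P J U ≤ LinearMap.ker (pencil (a j) (a k) θ)) ∨
    ∃ α β, α < β ∧ pencilRange a P J j k U = Set.Ioo α β ∧
      ∀ θ ∈ pencilRange a P J j k U, ∃ w ∈ flat a P J U, pencil (a j) (a k) θ w ≠ 0 := by
  obtain ⟨hUJ, w, hw, hc⟩ := mem_cells.1 hU
  by_cases hjk : j ∉ U ∧ k ∉ U
  · have hz : ∀ θ, ∀ v ∈ flat a P J U, pencil (a j) (a k) θ v = 0 := fun θ v hv => by
      rw [pencil_apply, hv.2 j hj hjk.1, hv.2 k hk hjk.2]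
      ring
    refine .inl ⟨0, 1, zero_le_one, ?_, fun θ _ v hv => hz θ v hv⟩
    exact Set.Subset.antisymm (fun θ hθ => hθ.1)
      fun θ hθ => ⟨hθ, w, hw, hc, hz θ w (hc.mem_flat hw)⟩
  have hpos : ∀ v, InCell a J U v → 0 < a j v + a k v := by
    intro v hv
    by_cases hjU : j ∈ U
    · exact add_pos_of_pos_of_nonneg ((hv j hj).1 hjU) (hv.nonneg hk)
    · by_cases hkU : k ∈ U
      · exact add_pos_of_nonneg_of_pos (hv.nonneg hj) ((hv k hk).1 hkU)
      · exact absurd ⟨hjU, hkU⟩ hjk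
  have hmem : ∀ v ∈ P, InCell a J U v → a j v / (a j v + a k v) ∈ pencilRange a P J j k U := by
    intro v hv hvc
    have h1 := hvc.nonneg hj
    have h2 := hvc.nonneg hk
    have h3 := hpos v hvc
    refine ⟨⟨by positivity, (div_le_one h3).2 (by linarith)⟩, v, hv, hvc, ?_⟩
    rw [pencil_apply, div_mul_cancel₀ _ h3.ne', sub_self]
  by_cases hpt : ∃ θ ∈ pencilRange a P J j k U,
      flat a P J U ≤ LinearMap.ker (pencil (a j) (a k) θ)
  · obtain ⟨θ₀, hθ₀, hker⟩ := hpt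
    have huniq : ∀ θ ∈ pencilRange a P J j k U, θ = θ₀ := by
      rintro θ ⟨-, v, hv, hvc, hv0⟩
      have h0 : pencil (a j) (a k) θ₀ v = 0 := hker (hvc.mem_flat hv)
      rw [pencil_apply] at hv0 h0
      exact mul_right_cancel₀ (hpos v hvc).ne' (by linarith)
    refine .inl ⟨θ₀, θ₀, le_rfl, ?_, fun θ hθ => huniq θ hθ ▸ hker⟩
    rw [Set.Icc_self]
    exact Set.Subset.antisymm huniq (by simpa using hθ₀)
  · have hex : ∀ θ ∈ pencilRange a P J j k U,
        ∃ w ∈ flat a P J U, pencil (a j) (a k) θ w ≠ 0 := by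
      intro θ hθ
      by_contra! hcon
      exact hpt ⟨θ, hθ, hcon⟩
    -- A small step along `u` stays in the cell, and the sign of `pencil θ u` decides in which
    -- direction the parameter moves. Here `S` is the value of `a j + a k` at the new point.
    have hmove : ∀ θ ∈ pencilRange a P J j k U, ∀ u ∈ flat a P J U, ∃ r > (0 : ℝ),
        ∃ θ' ∈ pencilRange a P J j k U, ∃ S > (0 : ℝ),
          (θ' - θ) * S = r * pencil (a j) (a k) θ u := by
      rintro θ ⟨hθ, v, hv, hvc, hv0⟩ u hu
      obtain ⟨r, hr, hr0⟩ := (((hvc.eventually hu.2).filter_mono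
        (nhdsWithin_le_nhds (s := Set.Ioi 0))).and self_mem_nhdsWithin).exists
      have hvP : v + r • u ∈ P := P.add_mem hv (P.smul_mem r hu.1)
      refine ⟨r, hr0, _, hmem _ hvP hr, _, hpos _ hr, ?_⟩
      rw [sub_mul, div_mul_cancel₀ _ (hpos _ hr).ne', ← pencil_apply, map_add, hv0, map_smul,
        zero_add, smul_eq_mul]
    have hup : ∀ θ ∈ pencilRange a P J j k U, ∀ u ∈ flat a P J U,
        0 < pencil (a j) (a k) θ u → ∃ θ' ∈ pencilRange a P J j k U, θ < θ' := by
      intro θ hθ u hu hpu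
      obtain ⟨r, hr, θ', hθ', S, hS, h⟩ := hmove θ hθ u hu
      refine ⟨θ', hθ', ?_⟩
      have : 0 < (θ' - θ) * S := h ▸ mul_pos hr hpu
      linarith [pos_of_mul_pos_left this hS.le]
    have hdown : ∀ θ ∈ pencilRange a P J j k U, ∀ u ∈ flat a P J U,
        pencil (a j) (a k) θ u < 0 → ∃ θ' ∈ pencilRange a P J j k U, θ' < θ := by
      intro θ hθ u hu hpu
      obtain ⟨r, hr, θ', hθ', S, hS, h⟩ := hmove θ hθ u hu
      refine ⟨θ', hθ', ?_⟩
      have : 0 < (θ - θ') * S := by nlinarith [mul_neg_of_pos_of_neg hr hpu]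
      linarith [pos_of_mul_pos_left this hS.le]
    have hneg : ∀ θ u, pencil (a j) (a k) θ (-u) = -pencil (a j) (a k) θ u :=
      fun θ u => map_neg _ u
    suffices ∃ α β, α < β ∧ pencilRange a P J j k U = Set.Ioo α β by
      obtain ⟨α, β, hαβ, h⟩ := this
      exact .inr ⟨α, β, hαβ, h, hex⟩
    refine eq_Ioo_of_no_extrema ⟨_, hmem w hw hc⟩ (fun θ hθ => hθ.1) ?_ ?_ ?_
    · intro θ hθ
      obtain ⟨u, hu, hu0⟩ := hex θ hθ
      rcases lt_or_gt_of_ne hu0 with h | h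
      · exact hup θ hθ (-u) (Submodule.neg_mem _ hu) (by rw [hneg]; linarith)
      · exact hup θ hθ u hu h
    · intro θ hθ
      obtain ⟨u, hu, hu0⟩ := hex θ hθ
      rcases lt_or_gt_of_ne hu0 with h | h
      · exact hdown θ hθ u hu h
      · exact hdown θ hθ (-u) (Submodule.neg_mem _ hu) (by rw [hneg]; linarith)
    · rintro θ₁ ⟨hθ₁, w₁, hw₁, hc₁, h₁⟩ θ₂ ⟨hθ₂, w₂, hw₂, hc₂, h₂⟩ θ hlt₁ hlt₂
      -- The positive weights `(θ₂ - θ) (a j + a k) w₂` and `(θ - θ₁) (a j + a k) w₁` make the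
      -- values of `pencil θ` at `w₁` and `w₂` cancel.
      refine ⟨⟨hθ₁.1.trans hlt₁.le, hlt₂.le.trans hθ₂.2⟩, _, ?_, hc₁.add_smul hc₂
        (mul_pos (sub_pos.2 hlt₂) (hpos w₂ hc₂)) (mul_pos (sub_pos.2 hlt₁) (hpos w₁ hc₁)), ?_⟩
      · exact P.add_mem (P.smul_mem _ hw₁) (P.smul_mem _ hw₂)
      · have e₁ : pencil (a j) (a k) θ w₁ = (θ₁ - θ) * (a j w₁ + a k w₁) := by
          rw [pencil_apply] at h₁ ⊢
          linarith
        have e₂ : pencil (a j) (a k) θ w₂ = (θ₂ - θ) * (a j w₂ + a k w₂) := by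
          rw [pencil_apply] at h₂ ⊢
          linarith
        rw [map_add, map_smul, map_smul, e₁, e₂, smul_eq_mul, smul_eq_mul]
        ring

open Classical in
theorem cells_pencil {j k : ι} {θ : ℝ} (hθ : θ ∈ Set.Icc (0 : ℝ) 1) :
    cells a (P ⊓ LinearMap.ker (pencil (a j) (a k) θ)) J =
      (cells a P J).filter fun U => θ ∈ pencilRange a P J j k U := by
  ext U
  rw [Finset.mem_filter, mem_cells, mem_cells]
  constructor
  · rintro ⟨hU, w, ⟨hw, hw0⟩, hc⟩
    exact ⟨⟨hU, w, hw, hc⟩, hθ, w, hw, hc, hw0⟩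
  · rintro ⟨⟨hU, -⟩, -, w, hw, hc, hw0⟩
    exact ⟨hU, w, ⟨hw, hw0⟩, hc⟩

theorem flat_inf (K : Submodule ℝ W) : flat a (P ⊓ K) J U = flat a P J U ⊓ K := by
  ext w
  simp only [mem_flat, Submodule.mem_inf]
  tauto

/-- **Euler's relation**: the alternating sum over the faces of a polyhedral cone that is not a
linear space vanishes. -/
theorem sum_neg_one_pow_finrank_flat [FiniteDimensional ℝ W]
    (h : ∃ U ∈ cells a P J, U.Nonempty) :
    ∑ U ∈ cells a P J, (-1 : ℤ) ^ Module.finrank ℝ (flat a P J U) = 0 := by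
  classical
  induction hn : Module.finrank ℝ P using Nat.strong_induction_on generalizing P with
  | _ n ih =>
  -- Without such a pair the cone is a half-space of its span and has two cells of consecutive
  -- dimensions. With one, the pencil of `a j` and `a k` gives slices that are again not linear.
  by_cases hinc : ∀ j ∈ J, ∀ k ∈ J, ∀ x ∈ P, ∀ y ∈ P, (∀ i ∈ J, 0 ≤ a i x) →
      (∀ i ∈ J, 0 ≤ a i y) → a j x = 0 → 0 < a k x → a k y = 0 → ¬ 0 < a j y
  · obtain ⟨U₀, hU₀, hne⟩ := h
    have hU : ∀ U ∈ cells a P J, U = ∅ ∨ U = U₀ := fun U hU => by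
      rcases U.eq_empty_or_nonempty with h | h
      · exact .inl h
      · exact .inr ((eq_of_no_incomparable hinc hU₀ hU hne).antisymm
          (eq_of_no_incomparable hinc hU hU₀ h))
    have : cells a P J = {∅, U₀} := by
      ext U
      rw [Finset.mem_insert, Finset.mem_singleton]
      refine ⟨hU U, ?_⟩
      rintro (rfl | rfl)
      exacts [empty_mem_cells, hU₀]
    rw [this, Finset.sum_pair hne.ne_empty.symm, finrank_flat_of_cells_subset hU hU₀ hne, pow_succ]
    ring
  push Not at hinc
  obtain ⟨j, hj, k, hk, x, hx, y, hy, hxn, hyn, hjx, hkx, hky, hjy⟩ := hinc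
  have hsec : ∀ θ ∈ Set.Icc (0 : ℝ) 1,
      ∑ U ∈ cells a (P ⊓ LinearMap.ker (pencil (a j) (a k) θ)) J,
        (-1 : ℤ) ^ Module.finrank ℝ
          (flat a (P ⊓ LinearMap.ker (pencil (a j) (a k) θ)) J U) = 0 := by
    intro θ hθ
    refine ih _ ?_ ?_ rfl
    · rw [← hn, ← finrank_inf_ker_add_one P (pencil (a j) (a k) θ)]
      · exact Nat.lt_succ_self _
      · rcases eq_or_ne θ 0 with rfl | h0
        · exact ⟨y, hy, by rw [pencil_apply, hky]; simpa using hjy.ne'⟩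
        · exact ⟨x, hx, by rw [pencil_apply, hjx]; simpa using ⟨h0, hkx.ne'⟩⟩
    · have h1θ : 0 ≤ 1 - θ := sub_nonneg.2 hθ.2
      -- The coefficients balance `pencil θ x = -θ * a k x` against `pencil θ y = (1 - θ) * a j y`.
      -- The resulting point of the cone has a positive coordinate, so the slice has a nonempty
      -- cell.
      have hz : ((1 - θ) * a j y) • x + (θ * a k x) • y ∈
          P ⊓ LinearMap.ker (pencil (a j) (a k) θ) := by
        refine ⟨P.add_mem (P.smul_mem _ hx) (P.smul_mem _ hy), ?_⟩
        rw [SetLike.mem_coe, LinearMap.mem_ker, map_add, map_smul, map_smul, pencil_apply,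
          pencil_apply, hjx, hky,
          smul_eq_mul, smul_eq_mul]
        ring
      obtain ⟨V, hV, hVc⟩ := exists_inCell_of_nonneg (a := a) (J := J) hz (fun i hi => by
        rw [map_add, map_smul, map_smul, smul_eq_mul, smul_eq_mul]
        exact add_nonneg (mul_nonneg (mul_nonneg h1θ hjy.le) (hxn i hi))
          (mul_nonneg (mul_nonneg hθ.1 hkx.le) (hyn i hi)))
      refine ⟨V, hV, ?_⟩
      rcases hθ.1.eq_or_lt with rfl | h0
      · refine ⟨k, (hVc.mem_iff hk).2 ?_⟩
        rw [map_add, map_smul, map_smul, hky]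
        simpa using mul_pos hjy hkx
      · refine ⟨j, (hVc.mem_iff hj).2 ?_⟩
        rw [map_add, map_smul, map_smul, hjx]
        simpa using mul_pos (mul_pos h0 hkx) hjy
  have hcls : ∀ U, ∃ ε : ℤ, U ∈ cells a P J →
      ((∃ α β, α ≤ β ∧ pencilRange a P J j k U = Set.Icc α β ∧ ε = 1) ∨
        ∃ α β, α < β ∧ pencilRange a P J j k U = Set.Ioo α β ∧ ε = -1) ∧
      ∀ θ ∈ pencilRange a P J j k U, (-1 : ℤ) ^ Module.finrank ℝ
          (flat a (P ⊓ LinearMap.ker (pencil (a j) (a k) θ)) J U) =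
        (-1) ^ Module.finrank ℝ (flat a P J U) * ε := by
    intro U
    by_cases hU : U ∈ cells a P J
    swap
    · exact ⟨0, fun h => absurd h hU⟩
    rcases pencilRange_eq hj hk hU with ⟨α, β, hαβ, hI, hd⟩ | ⟨α, β, hαβ, hI, hd⟩
    · refine ⟨1, fun _ => ⟨.inl ⟨α, β, hαβ, hI, rfl⟩, fun θ hθ => ?_⟩⟩
      rw [flat_inf, inf_eq_left.2 (hd θ hθ), mul_one]
    · refine ⟨-1, fun _ => ⟨.inr ⟨α, β, hαβ, hI, rfl⟩, fun θ hθ => ?_⟩⟩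
      rw [flat_inf, ← finrank_inf_ker_add_one _ _ (hd θ hθ), pow_succ]
      ring
  choose ε hε using hcls
  have hsq : ∀ U ∈ cells a P J, ε U * ε U = 1 := by
    intro U hU
    rcases (hε U hU).1 with ⟨_, _, _, _, h⟩ | ⟨_, _, _, _, h⟩ <;> rw [h] <;> norm_num
  -- The slice relations say that the indicators of the ranges, weighted by `(-1) ^ dim * ε`, sum to
  -- zero for every `θ`. Integration multiplies each weight by another `ε`, and `ε * ε = 1` leaves
  -- the desired sum.
  have := sum_mul_euler_eq_zero (cells a P J)
    (fun U => (-1) ^ Module.finrank ℝ (flat a P J U) * ε U) ε (pencilRange a P J j k)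
    (fun U hU => (hε U hU).1) ?_
  · rw [← this]
    refine Finset.sum_congr rfl fun U hU => ?_
    rw [mul_assoc, hsq U hU, mul_one]
  · intro θ
    by_cases hθ : θ ∈ Set.Icc (0 : ℝ) 1
    · refine Eq.trans ?_ (hsec θ hθ)
      rw [cells_pencil hθ, Finset.sum_filter]
      refine Finset.sum_congr rfl fun U hU => ?_
      split_ifs with hU'
      · exact ((hε U hU).2 θ hU').symm
      · rfl
    · exact Finset.sum_eq_zero fun U _ => if_neg fun h => hθ h.1

end ConeCells

/-! ### The face lattice of a polytope and the cone of affine functionals -/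

namespace Polytope

variable {V : Type*} [AddCommGroup V] [Module ℝ V]

/-- The linear span of the homogenization `{(v, 1) | v ∈ T}`. -/
def homogSpan (T : Set V) : Submodule ℝ (V × ℝ) := Submodule.span ℝ ((fun v => (v, 1)) '' T)

theorem mem_homogSpan {T : Set V} {v : V} (hv : v ∈ T) : (v, (1 : ℝ)) ∈ homogSpan T :=
  Submodule.subset_span ⟨v, hv, rfl⟩

instance (s : Finset V) : FiniteDimensional ℝ (homogSpan (s : Set V)) :=
  FiniteDimensional.span_of_finite ℝ (s.finite_toSet.image _)

/-- The part of the span at height zero is the direction space of the affine hull. -/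
theorem finrank_homogSpan (T : Finset V) (hT : T.Nonempty) :
    Module.finrank ℝ (homogSpan (T : Set V)) =
      Module.finrank ℝ (vectorSpan ℝ (T : Set V)) + 1 := by
  obtain ⟨t, ht⟩ := hT
  rw [← ConeCells.finrank_inf_ker_add_one (homogSpan (T : Set V)) (LinearMap.snd ℝ V ℝ)
    ⟨_, mem_homogSpan ht, one_ne_zero⟩]
  have hinj : Function.Injective (LinearMap.inl ℝ V ℝ) := LinearMap.inl_injective
  rw [(Submodule.equivMapOfInjective _ hinj (vectorSpan ℝ (T : Set V))).finrank_eq]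
  suffices h : homogSpan (T : Set V) ⊓ LinearMap.ker (LinearMap.snd ℝ V ℝ) =
      (vectorSpan ℝ (T : Set V)).map (LinearMap.inl ℝ V ℝ) by rw [h]
  -- Subtracting `p.2` times the generator `(t, 1)` brings `p` to height zero.
  have key : ∀ p ∈ homogSpan (T : Set V), p.1 - p.2 • t ∈ vectorSpan ℝ (T : Set V) := by
    intro p hp
    induction hp using Submodule.span_induction with
    | mem x hx =>
      obtain ⟨v, hv, rfl⟩ := hx
      rw [one_smul]
      exact vsub_mem_vectorSpan ℝ hv ht
    | zero => simp
    | add x y _ _ hx hy =>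
      have := add_mem hx hy
      rw [Prod.fst_add, Prod.snd_add, add_smul]
      convert this using 1
      abel
    | smul c x _ hx =>
      have := Submodule.smul_mem _ c hx
      rw [Prod.smul_fst, Prod.smul_snd, smul_eq_mul, mul_smul, ← smul_sub]
      exact this
  ext p
  constructor
  · rintro ⟨hp, hp0⟩
    have hp0' : p.2 = 0 := hp0
    have := key p hp
    rw [hp0', zero_smul, sub_zero] at this
    exact ⟨p.1, this, Prod.ext rfl hp0'.symm⟩
  · rintro ⟨v, hv, rfl⟩
    refine ⟨?_, rfl⟩
    rw [vectorSpan_eq_span_vsub_set_right ℝ ht] at hv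
    induction hv using Submodule.span_induction with
    | mem x hx =>
      obtain ⟨v, hv, rfl⟩ := hx
      have := sub_mem (mem_homogSpan hv) (mem_homogSpan ht)
      simpa using this
    | zero =>
      rw [map_zero]
      exact zero_mem _
    | add x y _ _ hx hy =>
      rw [map_add]
      exact add_mem hx hy
    | smul c x _ hx =>
      rw [map_smul]
      exact Submodule.smul_mem _ c hx

/-- Evaluation of the functionals on `homogSpan s` at the points of `s`. -/
noncomputable def evalAt (s : Finset V) (v : s) :
    Module.Dual ℝ (homogSpan (s : Set V)) →ₗ[ℝ] ℝ :=
  Module.Dual.eval ℝ _ ⟨(v.1, 1), mem_homogSpan v.2⟩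

theorem evalAt_apply (s : Finset V) (v : s) (φ : Module.Dual ℝ (homogSpan (s : Set V))) :
    evalAt s v φ = φ ⟨(v.1, 1), mem_homogSpan v.2⟩ := rfl

variable {Q : Polytope V} {s : Finset V}

open Classical in
/-- The points of `s` which do not lie on the face `G`. -/
noncomputable def offFace (s : Finset V) (G : Face Q) : Finset s :=
  Finset.univ.filter fun v => v.1 ∉ G.carrier

theorem mem_offFace {G : Face Q} {v : s} : v ∈ offFace s G ↔ v.1 ∉ G.carrier := by
  simp [offFace]

theorem offFace_subset_iff (hs : Q.carrier = convexHull ℝ (s : Set V)) {G H : Face Q} :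
    offFace s H ⊆ offFace s G ↔ G ≤ H := by
  classical
  constructor
  · intro h
    rw [Face.le_def]
    have h1 : G.carrier = _ := G.2.eq_convexHull hs
    have h2 : H.carrier = _ := H.2.eq_convexHull hs
    rw [h1, h2]
    refine convexHull_mono fun v hv => ?_
    obtain ⟨hvs, hvG⟩ := Finset.mem_filter.1 hv
    refine Finset.mem_filter.2 ⟨hvs, ?_⟩
    by_contra hvH
    exact mem_offFace.1 (h (mem_offFace.2 (show (⟨v, hvs⟩ : s).1 ∉ H.carrier from hvH))) hvG
  · exact fun h v hv => mem_offFace.2 fun hG => mem_offFace.1 hv (h hG)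

theorem exists_inCell_offFace (hs : Q.carrier = convexHull ℝ (s : Set V)) (G : Face Q) :
    ∃ φ, ConeCells.InCell (evalAt s) Finset.univ (offFace s G) φ := by
  obtain ⟨l, c, hl, hG⟩ := G.2
  refine ⟨(c • LinearMap.snd ℝ V ℝ - l.comp (LinearMap.fst ℝ V ℝ)).domRestrict _, ?_⟩
  intro v _
  have hvQ : v.1 ∈ Q.carrier := hs ▸ subset_convexHull ℝ _ v.2
  have hmem : v.1 ∈ G.carrier ↔ l v.1 = c := by
    change v.1 ∈ G.1 ↔ _
    rw [hG]
    simp [hvQ]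
  rw [mem_offFace, hmem, evalAt_apply]
  simp only [LinearMap.domRestrict_apply, LinearMap.sub_apply, LinearMap.smul_apply,
    LinearMap.snd_apply, LinearMap.comp_apply, LinearMap.fst_apply, smul_eq_mul, mul_one, not_not]
  exact ⟨fun h => sub_pos.2 (lt_of_le_of_ne (hl _ hvQ) h), fun h => by rw [h, sub_self]⟩

/-- A functional in the cone, extended to `V × ℝ`, is an affine function on `V` that is nonnegative
on `Q`; its zero set there is the face. -/
theorem exists_offFace_eq (hs : Q.carrier = convexHull ℝ (s : Set V)) {T : Finset s}
    {φ : Module.Dual ℝ (homogSpan (s : Set V))}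
    (h : ConeCells.InCell (evalAt s) Finset.univ T φ) : ∃ G : Face Q, offFace s G = T := by
  obtain ⟨f, hf⟩ := LinearMap.exists_extend φ
  have hev : ∀ v : s, evalAt s v φ = f (0, 1) + f (v.1, 0) := fun v => by
    rw [evalAt_apply, ← hf, ← map_add]
    simp
  have hle : ∀ x ∈ Q.carrier, (-(f.comp (LinearMap.inl ℝ V ℝ))) x ≤ f (0, 1) := by
    intro x hx
    have hconv : Convex ℝ {x | (-(f.comp (LinearMap.inl ℝ V ℝ))) x ≤ f (0, 1)} :=
      convex_halfSpace_le (LinearMap.isLinear _) _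
    rw [hs] at hx
    refine convexHull_min (fun v hv => ?_) hconv hx
    have := h.nonneg (Finset.mem_univ ⟨v, hv⟩)
    rw [hev] at this
    simp only [Set.mem_ofPred_eq, LinearMap.neg_apply, LinearMap.comp_apply, LinearMap.inl_apply]
    linarith
  have hface : Q.IsFace {x ∈ Q.carrier | (-(f.comp (LinearMap.inl ℝ V ℝ))) x = f (0, 1)} :=
    ⟨_, _, hle, rfl⟩
  let G : Face Q := Subtype.mk _ hface
  refine ⟨G, ?_⟩
  ext v
  have hvQ : v.1 ∈ Q.carrier := hs ▸ subset_convexHull ℝ _ v.2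
  have h0 := h.nonneg (Finset.mem_univ v)
  rw [mem_offFace, h.mem_iff (Finset.mem_univ v)]
  rw [hev] at h0 ⊢
  change ¬ (v.1 ∈ Q.carrier ∧ -(f (v.1, 0)) = f (0, 1)) ↔ _
  constructor
  · intro hn
    refine lt_of_le_of_ne h0 fun h => hn ⟨hvQ, by linarith⟩
  · rintro hp ⟨-, h⟩
    linarith

/-- The flat is the annihilator of the homogenized span of `G`, whose dimension is `dim G + 1`, also
for `G = ∅`. Codimension in the dual space thus realizes the rank function. -/
theorem finrank_flat_add_dimSucc (hs : Q.carrier = convexHull ℝ (s : Set V)) (G : Face Q) :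
    Module.finrank ℝ (ConeCells.flat (evalAt s) ⊤ Finset.univ (offFace s G)) +
      G.toPolytope.dimSucc = Module.finrank ℝ (homogSpan (s : Set V)) := by
  classical
  set N : Submodule ℝ (homogSpan (s : Set V)) :=
    Submodule.span ℝ {u | ∃ v : s, v.1 ∈ G.carrier ∧ u = ⟨(v.1, 1), mem_homogSpan v.2⟩} with hN
  have hflat : ConeCells.flat (evalAt s) ⊤ Finset.univ (offFace s G) = N.dualAnnihilator := by
    ext φ
    rw [ConeCells.mem_flat, Submodule.mem_dualAnnihilator]
    constructor
    · rintro ⟨-, h⟩ u hu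
      have : N ≤ LinearMap.ker φ := by
        rw [hN, Submodule.span_le]
        rintro _ ⟨v, hv, rfl⟩
        exact h v (Finset.mem_univ v) fun hv' => mem_offFace.1 hv' hv
      exact this hu
    · refine fun h => ⟨trivial, fun v _ hv => h _ (Submodule.subset_span ⟨v, ?_, rfl⟩)⟩
      rwa [mem_offFace, not_not] at hv
  have hmap : N.map (homogSpan (s : Set V)).subtype =
      homogSpan ((s.filter (· ∈ G.1) : Finset V) : Set V) := by
    rw [hN, Submodule.map_span]
    refine congrArg (Submodule.span ℝ) ?_
    ext p
    constructor
    · rintro ⟨_, ⟨v, hv, rfl⟩, rfl⟩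
      exact ⟨v.1, Finset.mem_filter.2 ⟨v.2, hv⟩, rfl⟩
    · rintro ⟨v, hv, rfl⟩
      obtain ⟨hvs, hvG⟩ := Finset.mem_filter.1 hv
      exact ⟨_, ⟨⟨v, hvs⟩, hvG, rfl⟩, rfl⟩
  have hdim : Module.finrank ℝ N = G.toPolytope.dimSucc := by
    rw [← Submodule.finrank_map_subtype_eq, hmap]
    have hG : G.toPolytope.carrier = _ := G.2.eq_convexHull hs
    unfold dimSucc dim
    rw [hG, ← direction_affineSpan, affineSpan_convexHull, direction_affineSpan]
    rcases (s.filter (· ∈ G.1)).eq_empty_or_nonempty with h | h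
    · rw [h, if_pos (by simp), homogSpan, Finset.coe_empty, Set.image_empty, Submodule.span_empty,
        finrank_bot]
    · rw [if_neg, finrank_homogSpan _ h]
      rw [convexHull_eq_empty, Finset.coe_eq_empty]
      exact h.ne_empty
  rw [hflat, ← hdim, add_comm]
  exact Subspace.finrank_add_finrank_dualAnnihilator_eq N

theorem flat_sdiff {G E H : Face Q} (hGE : G ≤ E) (hEH : E ≤ H) [DecidableEq s] :
    ConeCells.flat (evalAt s) (ConeCells.flat (evalAt s) ⊤ Finset.univ (offFace s G))
      (offFace s G \ offFace s H) (offFace s E \ offFace s H) =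
    ConeCells.flat (evalAt s) ⊤ Finset.univ (offFace s E) := by
  ext φ
  constructor
  · rintro ⟨⟨-, h1⟩, h2⟩
    refine ⟨trivial, fun v _ hv => ?_⟩
    by_cases hvG : v ∈ offFace s G
    · have hvH : v ∉ offFace s H := fun h => hv (mem_offFace.2 fun h' => mem_offFace.1 h (hEH h'))
      exact h2 v (Finset.mem_sdiff.2 ⟨hvG, hvH⟩) fun h => hv (Finset.mem_sdiff.1 h).1
    · exact h1 v (Finset.mem_univ v) hvG
  · rintro ⟨-, h⟩
    refine ⟨⟨trivial, fun v _ hv => h v (Finset.mem_univ v) fun hE => ?_⟩, fun v hv hvE => ?_⟩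
    · exact hv (mem_offFace.2 fun h' => mem_offFace.1 hE (hGE h'))
    · exact h v (Finset.mem_univ v) fun hE => hvE (Finset.mem_sdiff.2
        ⟨hE, (Finset.mem_sdiff.1 hv).2⟩)

/-- The cells of the cone attached to an interval `[G, H]` are the elements of the interval. -/
theorem mem_cells_sdiff (hs : Q.carrier = convexHull ℝ (s : Set V)) [DecidableEq s]
    {G H : Face Q} (hGH : G ≤ H) {U : Finset s} :
    U ∈ ConeCells.cells (evalAt s) (ConeCells.flat (evalAt s) ⊤ Finset.univ (offFace s G))
        (offFace s G \ offFace s H) ↔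
      ∃ E : Face Q, (G ≤ E ∧ E ≤ H) ∧ offFace s E \ offFace s H = U := by
  rw [ConeCells.mem_cells]
  constructor
  · rintro ⟨hU, φ, ⟨-, hφ⟩, hc⟩
    -- A functional `ψ` cutting out `H` repairs the signs of `φ` off `H`: for small `r > 0`, `ψ + r
    -- • φ` is positive there and equals `r • φ` on `H`.
    obtain ⟨ψ, hψ⟩ := exists_inCell_offFace hs H
    have hHG := (offFace_subset_iff hs).2 hGH
    have hev : ∀ᶠ r in nhds (0 : ℝ), ∀ v ∈ offFace s H, 0 < evalAt s v (ψ + r • φ) := by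
      refine (Filter.eventually_all_finset _).2 fun v hv => ?_
      have hcont : Continuous fun r : ℝ => evalAt s v ψ + r * evalAt s v φ := by fun_prop
      have h0 : 0 < evalAt s v ψ + 0 * evalAt s v φ := by
        simpa using (hψ v (Finset.mem_univ v)).1 hv
      filter_upwards [hcont.continuousAt.eventually (lt_mem_nhds h0)] with r hr
      simpa using hr
    obtain ⟨r, hr, hr0⟩ := ((hev.filter_mono
      (nhdsWithin_le_nhds (s := Set.Ioi 0))).and self_mem_nhdsWithin).exists
    have hcell : ConeCells.InCell (evalAt s) Finset.univ (U ∪ offFace s H) (ψ + r • φ) := by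
      intro v hv
      by_cases hvH : v ∈ offFace s H
      · exact ⟨fun _ => hr v hvH, fun h => absurd (Finset.mem_union_right _ hvH) h⟩
      have hval : evalAt s v (ψ + r • φ) = r * evalAt s v φ := by
        rw [map_add, map_smul, (hψ v hv).2 hvH, zero_add, smul_eq_mul]
      rw [hval, Finset.mem_union, or_iff_left hvH]
      by_cases hvG : v ∈ offFace s G
      · have hvJ := Finset.mem_sdiff.2 ⟨hvG, hvH⟩
        exact ⟨fun h => mul_pos hr0 ((hc v hvJ).1 h), fun h => by rw [(hc v hvJ).2 h, mul_zero]⟩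
      · exact ⟨fun h => absurd (Finset.mem_sdiff.1 (hU h)).1 hvG,
          fun _ => by rw [hφ v hv hvG, mul_zero]⟩
    obtain ⟨E, hE⟩ := exists_offFace_eq hs hcell
    refine ⟨E, ⟨(offFace_subset_iff hs).1 ?_, (offFace_subset_iff hs).1 ?_⟩, ?_⟩
    · rw [hE]
      exact Finset.union_subset (hU.trans Finset.sdiff_subset) hHG
    · rw [hE]
      exact Finset.subset_union_right
    · rw [hE, Finset.union_sdiff_right, Finset.sdiff_eq_self_iff_disjoint]
      exact Finset.disjoint_of_subset_left hU Finset.sdiff_disjoint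
  · rintro ⟨E, ⟨hGE, hEH⟩, rfl⟩
    have h1 := (offFace_subset_iff hs).2 hGE
    refine ⟨Finset.sdiff_subset_sdiff h1 le_rfl, ?_⟩
    obtain ⟨φ, hφ⟩ := exists_inCell_offFace hs E
    refine ⟨φ, ⟨trivial, fun v hv hvG => (hφ v hv).2 fun h => hvG (h1 h)⟩, fun v hv => ?_⟩
    have hvH := (Finset.mem_sdiff.1 hv).2
    rw [Finset.mem_sdiff, and_iff_left hvH]
    exact hφ v (Finset.mem_univ v)

theorem offFace_sdiff_injOn (hs : Q.carrier = convexHull ℝ (s : Set V)) [DecidableEq s]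
    {E E' H : Face Q} (hE : E ≤ H) (hE' : E' ≤ H)
    (h : offFace s E \ offFace s H = offFace s E' \ offFace s H) : E = E' := by
  have h1 := (offFace_subset_iff hs).2 hE
  have h2 := (offFace_subset_iff hs).2 hE'
  have : offFace s E = offFace s E' := by
    rw [← Finset.sdiff_union_of_subset h1, h, Finset.sdiff_union_of_subset h2]
  exact le_antisymm ((offFace_subset_iff hs).1 this.ge) ((offFace_subset_iff hs).1 this.le)

theorem exists_nonempty_cell (hs : Q.carrier = convexHull ℝ (s : Set V)) [DecidableEq s]
    {G H : Face Q} (hGH : G < H) : (offFace s G \ offFace s H).Nonempty := by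
  rw [Finset.nonempty_iff_ne_empty]
  intro h
  exact hGH.ne (offFace_sdiff_injOn hs hGH.le le_rfl (by rw [h, Finset.sdiff_self]))

/-- For a covering pair the cone of the interval has only the cells of its two ends, so it is a
half-space and the flats differ by one dimension. -/
theorem isRankFunction_rank (Q : Polytope V) : IsRankFunction Q.rank := by
  classical
  obtain ⟨s, hs⟩ := Q.exists_finset
  intro G H hGH
  have h := ConeCells.finrank_flat_of_cells_subset
    (P := ConeCells.flat (evalAt s) ⊤ Finset.univ (offFace s G)) (a := evalAt s)
    (J := offFace s G \ offFace s H) (U₀ := offFace s G \ offFace s H) ?_ ?_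
    (exists_nonempty_cell hs hGH.lt)
  · have h0 := flat_sdiff (s := s) hGH.le (le_refl H)
    rw [Finset.sdiff_self] at h0
    rw [flat_sdiff le_rfl hGH.le, h0] at h
    have h1 := finrank_flat_add_dimSucc hs G
    have h2 := finrank_flat_add_dimSucc hs H
    unfold rank
    omega
  · intro U hU
    obtain ⟨E, ⟨hGE, hEH⟩, rfl⟩ := (mem_cells_sdiff hs hGH.le).1 hU
    rcases hGH.eq_or_eq hGE hEH with rfl | rfl
    · exact .inr rfl
    · exact .inl (Finset.sdiff_self _)
  · exact (mem_cells_sdiff hs hGH.le).2 ⟨G, ⟨le_rfl, hGH.le⟩, rfl⟩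

theorem negOnePow_natCast (n : ℕ) : (((n : ℤ).negOnePow : ℤˣ) : ℤ) = (-1) ^ n := by
  simp [Int.negOnePow_def]

theorem isLowerEulerian_rank (Q : Polytope V) : IsLowerEulerian Q.rank where
  finite := inferInstance
  isRankFunction := Q.isRankFunction_rank
  exists_isLeast := ⟨⊥, fun _ => bot_le⟩
  alternating := by
    classical
    intro G H hGH
    obtain ⟨s, hs⟩ := Q.exists_finset
    have h := ConeCells.sum_neg_one_pow_finrank_flat
      (P := ConeCells.flat (evalAt s) ⊤ Finset.univ (offFace s G)) (a := evalAt s)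
      (J := offFace s G \ offFace s H)
      ⟨_, (mem_cells_sdiff hs hGH.le).2 ⟨G, ⟨le_rfl, hGH.le⟩, rfl⟩, exists_nonempty_cell hs hGH⟩
    -- A global sign turns the parity of the rank of a face into that of the complementary dimension
    -- of its flat.
    rw [← mul_eq_zero_iff_left (pow_ne_zero (Module.finrank ℝ (homogSpan (s : Set V)))
      (neg_ne_zero.2 (one_ne_zero (α := ℤ)))), Finset.mul_sum, ← h]
    refine Finset.sum_nbij (fun E => offFace s E \ offFace s H) ?_ ?_ ?_ ?_
    · exact fun E hE => (mem_cells_sdiff hs hGH.le).2 ⟨E, Finset.mem_Icc.1 hE, rfl⟩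
    · intro E hE E' hE'
      exact offFace_sdiff_injOn hs (Finset.mem_Icc.1 hE).2 (Finset.mem_Icc.1 hE').2
    · intro U hU
      obtain ⟨E, hE, rfl⟩ := (mem_cells_sdiff hs hGH.le).1 hU
      exact ⟨E, Finset.mem_coe.2 (Finset.mem_Icc.2 hE), rfl⟩
    · intro E hE
      obtain ⟨h1, h2⟩ := Finset.mem_Icc.1 hE
      rw [flat_sdiff h1 h2, rank, negOnePow_natCast, ← finrank_flat_add_dimSucc hs E, pow_add,
        mul_assoc, ← pow_add, ← two_mul, pow_mul]
      simp

end Polytope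

/-! ### Eulerian lattices -/

section EulerianLattice

theorem IsRankFunction.strictMono {B : Type*} [PartialOrder B] [LocallyFiniteOrder B] {ρ : B → ℤ}
    (h : IsRankFunction ρ) : StrictMono ρ :=
  (strictMono_iff_forall_covBy ρ).2 fun z z' hz => by rw [h z z' hz]; exact lt_add_one _

theorem IsRankFunction.mono {B : Type*} [PartialOrder B] [LocallyFiniteOrder B] {ρ : B → ℤ}
    (h : IsRankFunction ρ) {z z' : B} (hz : z ≤ z') : ρ z ≤ ρ z' :=
  h.strictMono.monotone hz

variable {Γ : Type*} [Lattice Γ] [LocallyFiniteOrder Γ] {ρ : Γ → ℤ} {q : Γ}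

open Classical in
/-- **Weisner's theorem** for Eulerian lattices. -/
theorem IsLowerEulerian.sum_sup_eq (h : IsLowerEulerian ρ) {x : Γ} (hx : ¬ q ≤ x) (y : Γ)
    (hxy : x ⊔ q ≤ y) :
    ∑ z ∈ Finset.Icc x y with z ⊔ q = y, (((ρ z).negOnePow : ℤˣ) : ℤ) = 0 := by
  have := h.finite
  induction y using WellFoundedLT.induction with
  | _ y ih =>
  have hlt : x < y := lt_of_le_of_ne (le_sup_left.trans hxy) fun he =>
    hx (he ▸ le_sup_right.trans hxy)
  have h0 := h.alternating x y hlt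
  -- The vanishing sum over `[x, y]` is grouped by the value of `z ⊔ q`. The fibres over values
  -- below `y` vanish by induction, leaving the fibre over `y`.
  rw [← Finset.sum_fiberwise_of_maps_to (g := fun z => z ⊔ q) (t := Finset.Icc (x ⊔ q) y),
    Finset.sum_eq_single_of_mem y (Finset.right_mem_Icc.2 hxy)] at h0
  · exact h0
  · intro w hw hwy
    obtain ⟨hw1, hw2⟩ := Finset.mem_Icc.1 hw
    rw [← ih w (lt_of_le_of_ne hw2 hwy) hw1]
    refine Finset.sum_congr ?_ fun _ _ => rfl
    ext z
    simp only [Finset.mem_filter, Finset.mem_Icc]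
    constructor
    · rintro ⟨⟨h1, -⟩, rfl⟩
      exact ⟨⟨h1, le_sup_left⟩, rfl⟩
    · rintro ⟨⟨h1, h2⟩, rfl⟩
      exact ⟨⟨h1, h2.trans hw2⟩, rfl⟩
  · intro z hz
    obtain ⟨h1, h2⟩ := Finset.mem_Icc.1 hz
    exact Finset.mem_Icc.2 ⟨sup_le_sup_right h1 q, sup_le h2 (le_sup_right.trans hxy)⟩

-- In Weisner's sum the only term above `q` is `y` itself; it is moved to the other side.
open Classical in
theorem IsLowerEulerian.sum_not_le_sup_eq (h : IsLowerEulerian ρ) {x y : Γ} (hx : ¬ q ≤ x)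
    (hxy : x ⊔ q ≤ y) :
    ∑ z ∈ Finset.Icc x y with ¬ q ≤ z ∧ z ⊔ q = y, (((ρ z).negOnePow : ℤˣ) : ℤ) =
      -(((ρ y).negOnePow : ℤˣ) : ℤ) := by
  have hqy : q ≤ y := le_sup_right.trans hxy
  have h0 := h.sum_sup_eq hx y hxy
  rw [← Finset.sum_filter_add_sum_filter_not _ (fun z => ¬ q ≤ z), Finset.filter_filter,
    Finset.filter_filter] at h0
  have h1 : (Finset.Icc x y).filter (fun z => z ⊔ q = y ∧ ¬ ¬ q ≤ z) = {y} := by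
    ext z
    simp only [Finset.mem_filter, Finset.mem_Icc, Finset.mem_singleton, not_not]
    constructor
    · rintro ⟨-, h2, h3⟩
      rwa [sup_eq_left.2 h3] at h2
    · rintro rfl
      exact ⟨⟨le_sup_left.trans hxy, le_rfl⟩, sup_eq_left.2 hqy, hqy⟩
  rw [h1, Finset.sum_singleton] at h0
  simp only [and_comm (a := ¬ q ≤ _)]
  linarith

/-- Above an element `x ≱ q` there is a coatom of `[x, y]` which is not above `q`. -/
theorem IsLowerEulerian.exists_covBy_not_le (h : IsLowerEulerian ρ) {x y : Γ} (hx : ¬ q ≤ x)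
    (hxy : x ⊔ q ≤ y) : ∃ x', x ≤ x' ∧ ¬ q ≤ x' ∧ x' ⋖ y := by
  classical
  have := h.finite
  have hlt : ∀ {z}, ¬ q ≤ z → z ≤ y → z < y := fun hz hzy =>
    lt_of_le_of_ne hzy fun he => hz (he ▸ le_sup_right.trans hxy)
  obtain ⟨x', ⟨hxx', hx'y, hqx'⟩, hmax⟩ :=
    (Set.toFinite {z | x ≤ z ∧ z ≤ y ∧ ¬ q ≤ z}).exists_maximal
      ⟨x, le_rfl, le_sup_left.trans hxy, hx⟩
  have habove : ∀ z, x' < z → z ≤ y → q ≤ z := by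
    intro z hz hzy
    by_contra hqz
    exact hz.not_ge (hmax ⟨hxx'.trans hz.le, hzy, hqz⟩ hz.le)
  -- If the join were smaller, maximality of `x'` would leave the sum of `sum_not_le_sup_eq` without
  -- terms, although its value is a sign.
  have hjoin : x' ⊔ q = y := by
    by_contra hne
    have h0 := h.sum_not_le_sup_eq hqx' (sup_le hx'y (le_sup_right.trans hxy))
    rw [Finset.sum_eq_zero] at h0
    · exact (Units.ne_zero _) (neg_eq_zero.1 h0.symm)
    · intro z hz
      obtain ⟨hz1, hz2, hz3⟩ := Finset.mem_filter.1 hz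
      obtain ⟨hz4, hz5⟩ := Finset.mem_Icc.1 hz1
      rcases hz4.eq_or_lt with rfl | hz4
      · exact absurd hz3 hne
      · exact absurd (habove z hz4 hz5) hz2
  refine ⟨x', hxx', hqx', hlt hqx' hx'y, fun z hz hzy => ?_⟩
  refine hzy.not_ge ?_
  rw [← hjoin]
  exact sup_le hz.le (habove z hz hzy.le)

/-- An order-convex subset has the same intervals as the whole poset. This serves for both `X` and
`Y`, the latter with `c = -1`. -/
theorem IsLowerEulerian.subtype_of_ordConnected (h : IsLowerEulerian ρ) {p : Γ → Prop}
    [LocallyFiniteOrder {z // p z}] (hp : ∀ x y z, p x → p y → x ≤ z → z ≤ y → p z)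
    (hleast : ∃ z₀, p z₀ ∧ ∀ z, p z → z₀ ≤ z) (c : ℤ) :
    IsLowerEulerian (fun z : {z // p z} => ρ z.1 + c) where
  finite := by
    have := h.finite
    infer_instance
  isRankFunction := by
    intro z z' hz
    have : z.1 ⋖ z'.1 := ⟨hz.lt, fun w hw hw' =>
      hz.2 (c := ⟨w, hp _ _ _ z.2 z'.2 hw.le hw'.le⟩) hw hw'⟩
    have := h.isRankFunction _ _ this
    dsimp only
    omega
  exists_isLeast := by
    obtain ⟨z₀, h₀, hz₀⟩ := hleast
    exact ⟨⟨z₀, h₀⟩, fun z => hz₀ z.1 z.2⟩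
  alternating := by
    intro z z' hz
    have h0 := h.alternating z.1 z'.1 hz
    have : Finset.Icc z.1 z'.1 = (Finset.Icc z z').map (Function.Embedding.subtype p) := by
      ext w
      simp only [Finset.mem_Icc, Finset.mem_map, Function.Embedding.subtype_apply, Subtype.exists,
        exists_and_right, exists_eq_right]
      constructor
      · rintro ⟨h1, h2⟩
        exact ⟨hp _ _ _ z.2 z'.2 h1 h2, h1, h2⟩
      · rintro ⟨_, h1, h2⟩
        exact ⟨h1, h2⟩
    rw [this, Finset.sum_map] at h0
    simp only [Function.Embedding.subtype_apply] at h0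
    simp only [Int.negOnePow_add, Units.val_mul, ← Finset.sum_mul, h0, zero_mul]

theorem IsLowerEulerian.isStrongFormalSubdivision (h : IsLowerEulerian ρ) (hq : ∃ z, ¬ q ≤ z)
    [Fintype {z : Γ // ¬ q ≤ z}] [LocallyFiniteOrder {z : Γ // ¬ q ≤ z}]
    [LocallyFiniteOrder {z : Γ // q ≤ z}] :
    IsStrongFormalSubdivision (sourceRank ρ q) (targetRank ρ q) (subdivisionMap q) := by
  classical
  have hlt : ∀ {z y}, ¬ q ≤ z → q ≤ y → z ≤ y → z < y := fun hz hq hzy =>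
    lt_of_le_of_ne hzy fun he => hz (he ▸ hq)
  obtain ⟨z₀, hz₀⟩ := h.exists_isLeast
  have hqz₀ : ¬ q ≤ z₀ := fun hqz => hq.elim fun z hz => hz (hqz.trans (hz₀ z))
  refine ⟨?_, ?_, ?_, ?_, ?_, ?_, ?_⟩
  · convert h.subtype_of_ordConnected (p := fun z => ¬ q ≤ z)
      (fun x y z _ hy _ hzy hz => hy (hz.trans hzy)) ⟨z₀, hqz₀, fun z _ => hz₀ z⟩ 0 using 1
    funext z
    exact (add_zero _).symm
  · exact h.subtype_of_ordConnected (p := fun z => q ≤ z)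
      (fun x y z hx _ hxz _ => hx.trans hxz) ⟨q, le_rfl, fun z hz => hz⟩ (-1)
  · exact fun x x' hx => sup_le_sup_right (α := Γ) hx q
  · intro x
    have := h.isRankFunction.strictMono (hlt x.2 le_sup_right (le_sup_left : x.1 ≤ x.1 ⊔ q))
    exact Int.le_sub_one_of_lt this
  · intro y
    obtain ⟨x', -, hqx', hcov⟩ := h.exists_covBy_not_le hqz₀ (sup_le (hz₀ y.1) y.2)
    refine ⟨⟨x', hqx'⟩, Subtype.ext ?_⟩
    exact (hcov.eq_or_eq le_sup_left (sup_le hcov.le y.2)).resolve_left fun he =>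
      hqx' (sup_eq_left.1 he)
  · intro x y hxy
    obtain ⟨x', hxx', hqx', hcov⟩ := h.exists_covBy_not_le x.2 (show x.1 ⊔ q ≤ y.1 from hxy)
    refine ⟨⟨x', hqx'⟩, hxx', ?_, Subtype.ext ?_⟩
    · change ρ x' = ρ y.1 - 1
      rw [h.isRankFunction _ _ hcov, add_sub_cancel_right]
    · exact (hcov.eq_or_eq le_sup_left (sup_le hcov.le y.2)).resolve_left fun he =>
        hqx' (sup_eq_left.1 he)
  · intro x y hxy
    have h0 := h.sum_not_le_sup_eq x.2 (show x.1 ⊔ q ≤ y.1 from hxy)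
    have hmap : (Finset.Icc x.1 y.1).filter (fun z => ¬ q ≤ z ∧ z ⊔ q = y.1) =
        (Finset.univ.filter fun x' : {z : Γ // ¬ q ≤ z} =>
          x ≤ x' ∧ subdivisionMap q x' = y).map (Function.Embedding.subtype _) := by
      ext w
      rw [Finset.mem_filter, Finset.mem_Icc, Finset.mem_map]
      constructor
      · rintro ⟨⟨h1, -⟩, h3, h4⟩
        exact ⟨⟨w, h3⟩, Finset.mem_filter.2 ⟨Finset.mem_univ _, h1, Subtype.ext h4⟩, rfl⟩
      · rintro ⟨w', hw', rfl⟩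
        obtain ⟨-, h1, h4⟩ := Finset.mem_filter.1 hw'
        have h4' : w'.1 ⊔ q = y.1 := congrArg Subtype.val h4
        exact ⟨⟨h1, h4' ▸ le_sup_left⟩, w'.2, h4'⟩
    rw [hmap, Finset.sum_map] at h0
    simp only [Function.Embedding.subtype_apply] at h0
    simp only [targetRank, sourceRank, Int.negOnePow_sub, Units.val_mul, ← Finset.mul_sum]
    calc _ = (((ρ y.1).negOnePow : ℤˣ) : ℤ) * ((Int.negOnePow 1 : ℤˣ) : ℤ) *
          -(((ρ y.1).negOnePow : ℤˣ) : ℤ) := by rw [← h0]; congr!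
      _ = 1 := by rw [Int.negOnePow_one]; simp

end EulerianLattice

/-! ### Kazhdan–Lusztig–Stanley theory -/

/-! ### Reflection and truncation of polynomials. -/

section Truncation

theorem Polynomial.reflect_sum {ι R : Type*} [Semiring R] (n : ℕ) (s : Finset ι) (f : ι → R[X]) :
    reflect n (∑ i ∈ s, f i) = ∑ i ∈ s, reflect n (f i) :=
  map_sum (⟨⟨reflect n, reflect_zero⟩, fun f g => reflect_add f g n⟩ : R[X] →+ R[X]) f s

/-- The part of `p` of degree less than `n / 2`. -/
noncomputable def lowerHalf (n : ℕ) (p : ℤ[X]) : ℤ[X] :=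
  ∑ i ∈ Finset.range ((n + 1) / 2), monomial i (p.coeff i)

theorem coeff_lowerHalf (n : ℕ) (p : ℤ[X]) (i : ℕ) :
    (lowerHalf n p).coeff i = if 2 * i < n then p.coeff i else 0 := by
  rw [lowerHalf, finsetSum_coeff]
  simp only [coeff_monomial, Finset.sum_ite_eq', Finset.mem_range]
  exact if_congr (by omega) rfl rfl

theorem two_mul_natDegree_lt {n : ℕ} (hn : 0 < n) {p : ℤ[X]} (h : ∀ i, n ≤ 2 * i → p.coeff i = 0) :
    2 * p.natDegree < n := by
  by_contra! hle
  have h0 := h _ hle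
  rw [coeff_natDegree, leadingCoeff_eq_zero] at h0
  rw [h0, natDegree_zero] at hle
  omega

theorem two_mul_natDegree_lowerHalf {n : ℕ} (hn : 0 < n) (p : ℤ[X]) :
    2 * (lowerHalf n p).natDegree < n :=
  two_mul_natDegree_lt hn fun i hi => by rw [coeff_lowerHalf, if_neg (by omega)]

theorem natDegree_lowerHalf_le (n : ℕ) (p : ℤ[X]) : (lowerHalf n p).natDegree ≤ n := by
  rcases n.eq_zero_or_pos with rfl | hn
  · simp [lowerHalf]
  · have := two_mul_natDegree_lowerHalf hn p
    omega

/-- An antisymmetric polynomial is determined by its lower half. -/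
theorem lowerHalf_sub_reflect {n : ℕ} {p : ℤ[X]} (hp : p.natDegree ≤ n) (h : reflect n p = -p) :
    lowerHalf n p - reflect n (lowerHalf n p) = p := by
  ext i
  have hi : p.coeff (revAt n i) = -p.coeff i := by
    rw [← coeff_reflect, h, coeff_neg]
  rw [coeff_sub, coeff_reflect, coeff_lowerHalf, coeff_lowerHalf]
  rcases le_or_gt i n with hin | hin
  · rw [revAt_le hin] at hi ⊢
    split_ifs with h1 h2 h2
    · omega
    · rw [sub_zero]
    · omega
    -- The middle coefficient equals its own negative, hence is zero over ℤ.
    · have : n - i = i := by omega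
      rw [this] at hi
      omega
  · rw [revAt_eq_self_of_lt hin, if_neg (by omega), coeff_eq_zero_of_natDegree_lt (by omega),
      sub_zero]

theorem eq_zero_of_reflect_eq_self {n : ℕ} {p : ℤ[X]} (hp : 2 * p.natDegree < n)
    (h : reflect n p = p) : p = 0 := by
  ext i
  rw [coeff_zero]
  by_cases hi : p.natDegree < i
  · exact coeff_eq_zero_of_natDegree_lt hi
  · rw [← h, coeff_reflect, revAt_le (by omega)]
    exact coeff_eq_zero_of_natDegree_lt (by omega)

theorem reflect_one_X_sub_one : reflect 1 (X - 1 : ℤ[X]) = 1 - X := by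
  rw [reflect_sub]
  congr 1
  · simp
  · simp

theorem natDegree_X_sub_one_pow_le (n : ℕ) : ((X - 1 : ℤ[X]) ^ n).natDegree ≤ n := by
  have : (X - 1 : ℤ[X]).natDegree ≤ 1 := by
    rw [← map_one C, natDegree_X_sub_C]
  simpa using natDegree_pow_le_of_le n this

theorem reflect_X_sub_one_pow (n : ℕ) : reflect n ((X - 1 : ℤ[X]) ^ n) = (1 - X) ^ n := by
  induction n with
  | zero => simp
  | succ n ih =>
    rw [pow_succ, reflect_mul _ _ (natDegree_X_sub_one_pow_le n)
      (by simpa using natDegree_X_sub_one_pow_le 1), ih, reflect_one_X_sub_one, pow_succ]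

end Truncation

/-! ### Units of the incidence algebra. -/

namespace IncidenceAlgebra

variable {𝕜 B : Type*} [Ring 𝕜] [PartialOrder B] [LocallyFiniteOrder B]

/-- Each factor must climb strictly, and an interval contains no chain longer than its cardinality.
Elements with unit diagonal are therefore unipotent on a finite poset. -/
theorem pow_apply_eq_zero [DecidableEq B] {f : IncidenceAlgebra 𝕜 B} (h : ∀ z, f z z = 0)
    (n : ℕ) (z z' : B) (hn : (Finset.Icc z z').card ≤ n) : (f ^ n) z z' = 0 := by
  induction n generalizing z' with
  | zero =>
    refine apply_eq_zero_of_not_le (fun hz => ?_) _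
    exact (Finset.card_pos.2 ⟨z, Finset.left_mem_Icc.2 hz⟩).ne' (Nat.le_zero.1 hn)
  | succ n ih =>
    rw [pow_succ, mul_apply]
    refine Finset.sum_eq_zero fun w hw => ?_
    obtain ⟨h1, h2⟩ := Finset.mem_Icc.1 hw
    rcases h2.eq_or_lt with rfl | h2
    · rw [h, mul_zero]
    · rw [ih, zero_mul]
      refine Nat.le_of_lt_succ (lt_of_lt_of_le (Finset.card_lt_card ?_) hn)
      refine ⟨Finset.Icc_subset_Icc_right h2.le, fun h3 => ?_⟩
      exact h2.not_ge (Finset.mem_Icc.1 (h3 (Finset.right_mem_Icc.2 (h1.trans h2.le)))).2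

theorem isUnit_of_apply_self [DecidableEq B] [Finite B] {f : IncidenceAlgebra 𝕜 B}
    (h : ∀ z, f z z = 1) : IsUnit f := by
  have := Fintype.ofFinite B
  have hn : IsNilpotent (f - 1) := ⟨Fintype.card B, by
    ext z z' _
    exact pow_apply_eq_zero (fun z => by rw [sub_apply, h, one_apply, if_pos rfl, sub_self]) _ _ _
      (Finset.card_le_univ _)⟩
  simpa using hn.isUnit_one_add

end IncidenceAlgebra

namespace KLS

/-! ### Reversal, the Eulerian kernel, and existence and uniqueness of the left KLS function. -/

section Poset

theorem wr_self {B : Type*} (ρ : B → ℤ) (z : B) : wr ρ z z = 0 := by simp [wr]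

variable {B : Type*} [PartialOrder B] {ρ : B → ℤ}

theorem rev_apply (p : IncidenceAlgebra ℤ[X] B) (z z' : B) :
    rev ρ p z z' = (p z z').reflect (wr ρ z z') := rfl

theorem eulerianKernel_apply {z z' : B} (h : z ≤ z') :
    eulerianKernel ρ z z' = (X - 1) ^ wr ρ z z' := if_pos h

theorem eulerianKernel_self (z : B) : eulerianKernel ρ z z = 1 := by
  rw [eulerianKernel_apply le_rfl, wr_self, pow_zero]

/-- The incidence algebra elements for which `rev` is meaningful. -/
def DegreeLE (ρ : B → ℤ) (p : IncidenceAlgebra ℤ[X] B) : Prop :=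
  ∀ z z', (p z z').natDegree ≤ wr ρ z z'

theorem degreeLE_eulerianKernel : DegreeLE ρ (eulerianKernel ρ) := by
  intro z z'
  by_cases h : z ≤ z'
  · rw [eulerianKernel_apply h]
    exact natDegree_X_sub_one_pow_le _
  · rw [IncidenceAlgebra.apply_eq_zero_of_not_le h, natDegree_zero]
    exact Nat.zero_le _

theorem rev_sub (f g : IncidenceAlgebra ℤ[X] B) (x y : B) :
    rev ρ (f - g) x y = rev ρ f x y - rev ρ g x y := by
  rw [rev_apply, IncidenceAlgebra.sub_apply, reflect_sub]
  rfl

variable [LocallyFiniteOrder B]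

theorem wr_add (h : IsRankFunction ρ) {x y z : B} (hxy : x ≤ y) (hyz : y ≤ z) :
    wr ρ x y + wr ρ y z = wr ρ x z := by
  have := h.mono hxy
  have := h.mono hyz
  unfold wr
  omega

theorem wr_pos (h : IsRankFunction ρ) {x y : B} (hxy : x < y) : 0 < wr ρ x y := by
  have := h.strictMono hxy
  unfold wr
  omega

theorem DegreeLE.mul (h : IsRankFunction ρ) {p r : IncidenceAlgebra ℤ[X] B} (hp : DegreeLE ρ p)
    (hr : DegreeLE ρ r) : DegreeLE ρ (p * r) := by
  intro z z'
  rw [IncidenceAlgebra.mul_apply]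
  refine natDegree_sum_le_of_forall_le _ _ fun w hw => ?_
  obtain ⟨h1, h2⟩ := Finset.mem_Icc.1 hw
  rw [← wr_add h h1 h2]
  exact natDegree_mul_le_of_le (hp z w) (hr w z')

theorem rev_mul (h : IsRankFunction ρ) {p r : IncidenceAlgebra ℤ[X] B} (hp : DegreeLE ρ p)
    (hr : DegreeLE ρ r) : rev ρ (p * r) = rev ρ p * rev ρ r := by
  ext1 z z' _
  rw [rev_apply, IncidenceAlgebra.mul_apply, IncidenceAlgebra.mul_apply, reflect_sum]
  refine Finset.sum_congr rfl fun w hw => ?_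
  obtain ⟨h1, h2⟩ := Finset.mem_Icc.1 hw
  rw [← wr_add h h1 h2, reflect_mul _ _ (hp z w) (hr w z')]
  rfl

/-- The summands of `κ * κ^rev`. -/
theorem eulerianKernel_mul_rev (h : IsRankFunction ρ) {x y z : B} (hxz : x ≤ z) (hzy : z ≤ y) :
    eulerianKernel ρ x z * rev ρ (eulerianKernel ρ) z y =
      (X - 1) ^ wr ρ x y *
        C ((((ρ y).negOnePow : ℤˣ) : ℤ) * (((ρ z).negOnePow : ℤˣ) : ℤ)) := by
  rw [rev_apply, eulerianKernel_apply hxz, eulerianKernel_apply hzy, reflect_X_sub_one_pow,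
    ← wr_add h hxz hzy, pow_add, mul_assoc]
  congr 1
  have h1 : (1 - X : ℤ[X]) = -1 * (X - 1) := by ring
  have h2 : (((ρ y).negOnePow : ℤˣ) : ℤ) * (((ρ z).negOnePow : ℤˣ) : ℤ) = (-1) ^ wr ρ z y := by
    have := h.mono hzy
    rw [← Units.val_mul, ← Int.negOnePow_sub, wr, ← Polytope.negOnePow_natCast,
      Int.toNat_of_nonneg (by omega)]
  rw [h1, mul_pow, h2, map_pow, map_neg, map_one, mul_comm]

theorem sum_eulerianKernel_mul_rev (h : IsRankFunction ρ) {x y : B} {S : Finset B}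
    (hS : S ⊆ Finset.Icc x y) :
    ∑ z ∈ S, eulerianKernel ρ x z * rev ρ (eulerianKernel ρ) z y =
      (X - 1) ^ wr ρ x y *
        C ((((ρ y).negOnePow : ℤˣ) : ℤ) * ∑ z ∈ S, (((ρ z).negOnePow : ℤˣ) : ℤ)) := by
  rw [Finset.mul_sum, map_sum, Finset.mul_sum]
  refine Finset.sum_congr rfl fun z hz => ?_
  obtain ⟨h1, h2⟩ := Finset.mem_Icc.1 (hS hz)
  exact eulerianKernel_mul_rev h h1 h2

theorem eulerianKernel_mul_rev_eq_one [DecidableEq B] (h : IsLowerEulerian ρ) :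
    eulerianKernel ρ * rev ρ (eulerianKernel ρ) = 1 := by
  ext1 x y hxy
  rw [IncidenceAlgebra.mul_apply, IncidenceAlgebra.one_apply]
  rcases hxy.eq_or_lt with rfl | hlt
  · rw [Finset.Icc_self, Finset.sum_singleton, rev_apply, eulerianKernel_self, wr_self, if_pos rfl,
      one_mul]
    simp
  · rw [sum_eulerianKernel_mul_rev h.isRankFunction le_rfl, h.alternating x y hlt, if_neg hlt.ne,
      mul_zero, map_zero, mul_zero]

theorem IsLeftKLS.degreeLE {κ g : IncidenceAlgebra ℤ[X] B} (hg : IsLeftKLS ρ κ g) :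
    DegreeLE ρ g := by
  intro z z'
  by_cases h : z ≤ z'
  · rcases h.eq_or_lt with rfl | h
    · rw [hg.apply_self, natDegree_one]
      exact Nat.zero_le _
    · have := hg.degree_lt z z' h
      omega
  · rw [IncidenceAlgebra.apply_eq_zero_of_not_le h, natDegree_zero]
    exact Nat.zero_le _

theorem IsLeftKLS.two_mul_natDegree_le {κ g : IncidenceAlgebra ℤ[X] B} (hg : IsLeftKLS ρ κ g)
    (z z' : B) : 2 * (g z z').natDegree ≤ wr ρ z z' := by
  by_cases h : z ≤ z'
  · rcases h.eq_or_lt with rfl | h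
    · rw [hg.apply_self, natDegree_one]
      exact Nat.zero_le _
    · exact (hg.degree_lt z z' h).le
  · rw [IncidenceAlgebra.apply_eq_zero_of_not_le h, natDegree_zero]
    exact Nat.zero_le _

/-- A row of low degree satisfying the equation `d^rev = d * κ` vanishes. -/
theorem eq_zero_of_rev_eq [WellFoundedLT B] {d : IncidenceAlgebra ℤ[X] B} {x : B}
    (hd : ∀ y, x ≤ y → d x y = 0 ∨ 2 * (d x y).natDegree < wr ρ x y ∧
      rev ρ d x y = (d * eulerianKernel ρ) x y) (y : B) (hxy : x ≤ y) : d x y = 0 := by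
  induction y using WellFoundedLT.induction with
  | _ y ih =>
  rcases hd y hxy with h | ⟨h1, h2⟩
  · exact h
  · refine eq_zero_of_reflect_eq_self h1 ?_
    -- By induction only the term `z = y` survives, so `d x y` equals its own reflection. Degree
    -- below half then forces it to vanish.
    rw [← rev_apply, h2, IncidenceAlgebra.mul_apply,
      Finset.sum_eq_single_of_mem y (Finset.right_mem_Icc.2 hxy), eulerianKernel_self, mul_one]
    intro z hz hzy
    obtain ⟨h3, h4⟩ := Finset.mem_Icc.1 hz
    rw [ih z (lt_of_le_of_ne h4 hzy) h3, zero_mul]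

theorem sub_mul_apply (f g k : IncidenceAlgebra ℤ[X] B) (x y : B) :
    ((f - g) * k) x y = (f * k) x y - (g * k) x y := by
  simp only [IncidenceAlgebra.mul_apply, IncidenceAlgebra.sub_apply, sub_mul,
    Finset.sum_sub_distrib]

theorem two_mul_natDegree_sub_lt {n : ℕ} {p r : ℤ[X]} (hp : 2 * p.natDegree < n)
    (hr : 2 * r.natDegree < n) : 2 * (p - r).natDegree < n := by
  have := natDegree_sub_le p r
  omega

theorem IsLeftKLS.unique [WellFoundedLT B] {g g' : IncidenceAlgebra ℤ[X] B}
    (hg : IsLeftKLS ρ (eulerianKernel ρ) g) (hg' : IsLeftKLS ρ (eulerianKernel ρ) g') : g = g' := by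
  ext1 x y hxy
  rw [← sub_eq_zero, ← IncidenceAlgebra.sub_apply]
  refine eq_zero_of_rev_eq (ρ := ρ) (fun y hxy => ?_) y hxy
  rw [IncidenceAlgebra.sub_apply]
  rcases hxy.eq_or_lt with rfl | h
  · exact .inl (by rw [hg.apply_self, hg'.apply_self, sub_self])
  · refine .inr ⟨two_mul_natDegree_sub_lt (hg.degree_lt x y h) (hg'.degree_lt x y h), ?_⟩
    rw [rev_sub, sub_mul_apply, hg.rev_eq, hg'.rev_eq]

open Classical in
/-- The recursive construction of the left Kazhdan–Lusztig–Stanley function. -/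
noncomputable def klsFun (ρ : B → ℤ) (x : B) : B → ℤ[X]
  | y => if x = y then 1 else
    -lowerHalf (wr ρ x y) (∑ z ∈ (Finset.Ico x y).attach,
      have : (Finset.Icc x z.1).card < (Finset.Icc x y).card := by
        obtain ⟨h1, h2⟩ := Finset.mem_Ico.1 z.2
        refine Finset.card_lt_card ⟨Finset.Icc_subset_Icc_right h2.le, fun h3 => ?_⟩
        exact h2.not_ge (Finset.mem_Icc.1 (h3 (Finset.right_mem_Icc.2 (h1.trans h2.le)))).2
      klsFun ρ x z.1 * eulerianKernel ρ z.1 y)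
termination_by y => (Finset.Icc x y).card

theorem klsFun_self (x : B) : klsFun ρ x x = 1 := by
  rw [klsFun, if_pos rfl]

theorem klsFun_of_ne {x y : B} (h : x ≠ y) :
    klsFun ρ x y =
      -lowerHalf (wr ρ x y) (∑ z ∈ Finset.Ico x y, klsFun ρ x z * eulerianKernel ρ z y) := by
  rw [klsFun, if_neg h]
  exact congrArg (fun p => -lowerHalf _ p)
    (Finset.sum_attach (Finset.Ico x y) fun z => klsFun ρ x z * eulerianKernel ρ z y)

theorem natDegree_klsFun_le (x y : B) : (klsFun ρ x y).natDegree ≤ wr ρ x y := by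
  by_cases h : x = y
  · rw [← h, klsFun_self, natDegree_one]
    exact Nat.zero_le _
  · rw [klsFun_of_ne h, natDegree_neg]
    exact natDegree_lowerHalf_le _ _

/-- With `p` the sum over `z < y`, the equation reads `g^rev - g = p`. The choice `g = -lowerHalf p`
solves it as soon as `p` is antisymmetric. -/
theorem reflect_klsFun [WellFoundedLT B] (h : IsLowerEulerian ρ) {x y : B} (hxy : x ≤ y) :
    reflect (wr ρ x y) (klsFun ρ x y) =
      ∑ z ∈ Finset.Icc x y, klsFun ρ x z * eulerianKernel ρ z y := by
  classical
  have hr := h.isRankFunction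
  induction y using WellFoundedLT.induction with
  | _ y ih =>
  rcases hxy.eq_or_lt with rfl | hlt
  · rw [Finset.Icc_self, Finset.sum_singleton, klsFun_self, eulerianKernel_self, wr_self]
    simp
  set p := ∑ z ∈ Finset.Ico x y, klsFun ρ x z * eulerianKernel ρ z y with hp
  have hmem : ∀ z ∈ Finset.Ico x y, x ≤ z ∧ z < y := fun z hz => Finset.mem_Ico.1 hz
  have hdeg : p.natDegree ≤ wr ρ x y := by
    refine natDegree_sum_le_of_forall_le _ _ fun z hz => ?_
    rw [← wr_add hr (hmem z hz).1 (hmem z hz).2.le]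
    exact natDegree_mul_le_of_le (natDegree_klsFun_le x z) (degreeLE_eulerianKernel z y)
  have hone : ∀ w, w < y → ∑ z ∈ Finset.Ico w y,
      eulerianKernel ρ w z * rev ρ (eulerianKernel ρ) z y = -eulerianKernel ρ w y := by
    intro w hw
    have h1 : (eulerianKernel ρ * rev ρ (eulerianKernel ρ)) w y = 0 := by
      rw [eulerianKernel_mul_rev_eq_one h, IncidenceAlgebra.one_apply, if_neg hw.ne]
    have h2 : rev ρ (eulerianKernel ρ) y y = 1 := by
      rw [rev_apply, eulerianKernel_self, wr_self]
      simp
    rw [IncidenceAlgebra.mul_apply, ← Finset.Ico_insert_right hw.le, Finset.sum_insert (by simp),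
      h2, mul_one] at h1
    exact eq_neg_of_add_eq_zero_right h1
  -- Reflecting `p` and inserting the equation for each `z < y` gives a double sum over `w ≤ z`.
  -- Summing over `z` first, `κ * κ^rev = 1` without its term at `y` leaves `-κ w y`.
  have hanti : reflect (wr ρ x y) p = -p := by
    have h1 : reflect (wr ρ x y) p = ∑ z ∈ Finset.Ico x y, ∑ w ∈ Finset.Icc x z,
        klsFun ρ x w * (eulerianKernel ρ w z * rev ρ (eulerianKernel ρ) z y) := by
      rw [hp, reflect_sum]
      refine Finset.sum_congr rfl fun z hz => ?_
      rw [← wr_add hr (hmem z hz).1 (hmem z hz).2.le, reflect_mul _ _ (natDegree_klsFun_le x z)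
        (degreeLE_eulerianKernel z y), ih z (hmem z hz).2 (hmem z hz).1, Finset.sum_mul]
      exact Finset.sum_congr rfl fun w _ => mul_assoc _ _ _
    rw [h1, Finset.sum_comm' (t' := Finset.Ico x y) (s' := fun w => Finset.Ico w y), hp,
      ← Finset.sum_neg_distrib]
    · refine Finset.sum_congr rfl fun w hw => ?_
      rw [← Finset.mul_sum, hone w (hmem w hw).2, mul_neg]
    · intro z w
      simp only [Finset.mem_Ico, Finset.mem_Icc]
      constructor
      · rintro ⟨⟨-, h2⟩, h3, h4⟩
        exact ⟨⟨h4, h2⟩, h3, h4.trans_lt h2⟩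
      · rintro ⟨⟨h1, h2⟩, h3, -⟩
        exact ⟨⟨h3.trans h1, h2⟩, h3, h1⟩
  rw [← Finset.Ico_insert_right hxy, Finset.sum_insert (by simp), eulerianKernel_self, mul_one,
    ← hp, klsFun_of_ne hlt.ne, ← hp, reflect_neg]
  have := lowerHalf_sub_reflect hdeg hanti
  linear_combination this

/-- Lower Eulerian posets have a left Kazhdan–Lusztig–Stanley function. -/
theorem exists_isLeftKLS (h : IsLowerEulerian ρ) : ∃ g, IsLeftKLS ρ (eulerianKernel ρ) g := by
  classical
  have := h.finite
  let g : IncidenceAlgebra ℤ[X] B :=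
    ⟨fun x y => if x ≤ y then klsFun ρ x y else 0, fun _ _ h => if_neg h⟩
  have hg : ∀ {x y}, x ≤ y → g x y = klsFun ρ x y := fun h => if_pos h
  refine ⟨g, fun z => ?_, fun x y hxy => ?_, ?_⟩
  · rw [hg le_rfl, klsFun_self]
  · rw [hg hxy.le, klsFun_of_ne hxy.ne, natDegree_neg]
    exact two_mul_natDegree_lowerHalf (wr_pos h.isRankFunction hxy) _
  · ext1 x y hxy
    rw [rev_apply, hg hxy, reflect_klsFun h hxy, IncidenceAlgebra.mul_apply]
    exact Finset.sum_congr rfl fun z hz => by rw [hg (Finset.mem_Icc.1 hz).1]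

theorem isLeftKLS_leftKLS (h : IsLowerEulerian ρ) :
    IsLeftKLS ρ (eulerianKernel ρ) (leftKLS ρ) := by
  have hex := exists_isLeftKLS h
  rw [leftKLS, dif_pos hex]
  exact hex.choose_spec

theorem existsUnique_isLeftKLS (h : IsLowerEulerian ρ) :
    ∃! g, IsLeftKLS ρ (eulerianKernel ρ) g := by
  have := h.finite
  exact ⟨leftKLS ρ, isLeftKLS_leftKLS h, fun g hg => hg.unique (isLeftKLS_leftKLS h)⟩

end Poset

end KLS

namespace KLS

/-! ### Symmetric polynomials and their differences -/

section Delta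

theorem coeff_delta (m : ℕ) (a : ℤ[X]) (i : ℕ) :
    (delta m a).coeff i = if i = 0 then a.coeff 0 else
      if i ≤ m / 2 then a.coeff i - a.coeff (i - 1) else 0 := by
  rw [delta, coeff_add, finsetSum_coeff, coeff_C]
  simp only [coeff_C_mul, coeff_X_pow, mul_ite, mul_one, mul_zero, Finset.sum_ite_eq,
    Finset.mem_Icc]
  rcases i.eq_zero_or_pos with rfl | hi
  · simp
  · rw [if_neg hi.ne', if_neg hi.ne', zero_add]
    exact if_congr (and_iff_right hi) rfl rfl

/-- Multiplication by `1 - X` takes successive differences, and `i ≤ m / 2` means `2 * i < m + 1`.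
Thus `Δ` is a truncation of the kind used for KLS functions. -/
theorem delta_eq_lowerHalf (m : ℕ) (a : ℤ[X]) :
    delta m a = lowerHalf (m + 1) (-((X - 1) * a)) := by
  ext i
  rw [coeff_delta, coeff_lowerHalf, coeff_neg, sub_mul, one_mul, coeff_sub]
  rcases i with _ | i
  · rw [if_pos rfl, if_pos (by omega), coeff_X_mul_zero]
    ring
  · rw [if_neg (Nat.succ_ne_zero i), coeff_X_mul, Nat.add_sub_cancel]
    refine if_congr (by omega) (by ring) rfl

theorem isSymmetric_of_reflect {m : ℕ} {a : ℤ[X]} (hdeg : ((X - 1) * a).natDegree ≤ m + 1)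
    (h : reflect (m + 1) ((X - 1) * a) = -((X - 1) * a)) : IsSymmetric m a := by
  have hmonic : (X - 1 : ℤ[X]).Monic := by simpa using monic_X_sub_C (1 : ℤ)
  have hX : (X - 1 : ℤ[X]).natDegree = 1 := by simpa using natDegree_X_sub_C (1 : ℤ)
  have hm : a.natDegree ≤ m := by
    rcases eq_or_ne a 0 with rfl | ha
    · simp
    · rw [hmonic.natDegree_mul' ha, hX] at hdeg
      omega
  refine ⟨hm, fun i hi => ?_⟩
  rw [add_comm m 1, reflect_mul _ _ hX.le hm, reflect_one_X_sub_one, ← neg_mul, neg_sub] at h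
  have hne : (1 - X : ℤ[X]) ≠ 0 := by
    rw [← neg_sub, neg_ne_zero]
    exact hmonic.ne_zero
  rw [← revAt_le hi, ← coeff_reflect, mul_left_cancel₀ hne h]

theorem nonneg_delta_iff {m : ℕ} {a : ℤ[X]} (h : IsSymmetric m a) :
    Nonneg (delta m a) ↔ Nonneg a ∧ Unimodal a := by
  obtain ⟨hdeg, hsymm⟩ := h
  constructor
  · intro hd
    have h0 : 0 ≤ a.coeff 0 := by simpa [coeff_delta] using hd 0
    have hstep : ∀ i, i + 1 ≤ m / 2 → a.coeff i ≤ a.coeff (i + 1) := by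
      intro i hi
      have := hd (i + 1)
      rw [coeff_delta, if_neg (Nat.succ_ne_zero i), if_pos hi, Nat.add_sub_cancel] at this
      linarith
    have hinc : ∀ i j, i ≤ j → j ≤ m / 2 → a.coeff i ≤ a.coeff j := by
      intro i j hij
      induction j, hij using Nat.le_induction with
      | base => exact fun _ => le_rfl
      | succ j _ ih => exact fun hj => (ih (by omega)).trans (hstep j hj)
    have hlow : ∀ i, i ≤ m / 2 → 0 ≤ a.coeff i := fun i hi => h0.trans (hinc 0 i (Nat.zero_le i) hi)
    have hnn : Nonneg a := by
      intro i
      by_cases him : i ≤ m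
      · by_cases hi : i ≤ m / 2
        · exact hlow i hi
        · rw [hsymm i him]
          exact hlow _ (by omega)
      · rw [coeff_eq_zero_of_natDegree_lt (by omega)]
    refine ⟨hnn, m / 2, hinc, fun i j hi hij => ?_⟩
    by_cases hj : j ≤ m
    · rw [hsymm j hj]
      rcases hi.eq_or_lt with rfl | hi
      · by_cases hj' : m - j ≤ m / 2
        · exact hinc _ _ hj' le_rfl
        · have : j = m / 2 := by omega
          rw [← hsymm j hj, this]
      · rw [hsymm i (by omega)]
        exact hinc _ _ (by omega) (by omega)
    · rw [coeff_eq_zero_of_natDegree_lt (show a.natDegree < j by omega)]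
      exact hnn i
  · rintro ⟨hnn, k, hinc, hdec⟩ i
    rw [coeff_delta]
    split_ifs with h1 h2
    · exact hnn 0
    · rw [sub_nonneg]
      rcases le_or_gt i k with hik | hik
      · exact hinc _ _ (Nat.sub_le _ _) hik
      -- Past the peak, `a (i - 1)` is replaced by its mirror image `a (m - i + 1)`, whose index is
      -- at least `i` because `i ≤ m / 2`.
      · rw [hsymm (i - 1) (by omega)]
        exact hdec _ _ hik.le (by omega)
    · exact le_rfl

end Delta

/-! ### Local `h`-polynomials -/

section LocalH

variable {Γ : Type*} [Lattice Γ] {ρ : Γ → ℤ} {q : Γ}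

open Classical in
theorem kernelAlong_apply (x y : Γ) :
    kernelAlong ρ q x y = if ¬ q ≤ x ∧ x ⊔ q = y then eulerianKernel ρ x y else 0 := by
  refine if_congr ?_ rfl rfl
  exact ⟨fun ⟨h1, h2⟩ => ⟨h1, h2.symm⟩, fun ⟨h1, h2⟩ => ⟨h1, h2.symm⟩⟩

theorem kernelAlong_eq_zero {x y : Γ} (h : ¬ (¬ q ≤ x ∧ x ⊔ q = y)) : kernelAlong ρ q x y = 0 := by
  classical rw [kernelAlong_apply, if_neg h]

theorem kernelAlong_sup {x : Γ} (h : ¬ q ≤ x) :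
    kernelAlong ρ q x (x ⊔ q) = eulerianKernel ρ x (x ⊔ q) := by
  classical rw [kernelAlong_apply, if_pos ⟨h, rfl⟩]

theorem degreeLE_kernelAlong : DegreeLE ρ (kernelAlong ρ q) := by
  classical
  intro x y
  rw [kernelAlong_apply]
  split_ifs
  · exact degreeLE_eulerianKernel x y
  · rw [natDegree_zero]
    exact Nat.zero_le _

open Classical in
/-- The restriction of `f` to the intervals whose upper end is above `q`. -/
noncomputable def restrictAbove (q : Γ) (f : IncidenceAlgebra ℤ[X] Γ) :
    IncidenceAlgebra ℤ[X] Γ where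
  toFun := fun x y => if q ≤ y then f x y else 0
  eq_zero_of_not_le' := fun x y h => by
    rw [IncidenceAlgebra.apply_eq_zero_of_not_le h, ite_self]

theorem restrictAbove_of_le {f : IncidenceAlgebra ℤ[X] Γ} {x y : Γ} (h : q ≤ y) :
    restrictAbove q f x y = f x y := if_pos h

theorem restrictAbove_of_not_le {f : IncidenceAlgebra ℤ[X] Γ} {x y : Γ} (h : ¬ q ≤ y) :
    restrictAbove q f x y = 0 := if_neg h

variable [LocallyFiniteOrder Γ]

theorem kernelAlong_mul_eulerianKernel (h : IsRankFunction ρ) {x y : Γ} (hx : ¬ q ≤ x)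
    (hxy : x ⊔ q ≤ y) : (kernelAlong ρ q * eulerianKernel ρ) x y = eulerianKernel ρ x y := by
  have hle : x ≤ x ⊔ q := le_sup_left
  rw [IncidenceAlgebra.mul_apply,
    Finset.sum_eq_single_of_mem (x ⊔ q) (Finset.mem_Icc.2 ⟨hle, hxy⟩), kernelAlong_sup hx,
    eulerianKernel_apply hle, eulerianKernel_apply hxy, eulerianKernel_apply (hle.trans hxy),
    ← pow_add, wr_add h hle hxy]
  intro z _ hz
  rw [kernelAlong_eq_zero fun hz' => hz hz'.2.symm, zero_mul]

theorem kernelAlong_mul_eulerianKernel_eq_zero {x y : Γ} (h : ¬ (¬ q ≤ x ∧ x ⊔ q ≤ y)) :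
    (kernelAlong ρ q * eulerianKernel ρ) x y = 0 := by
  rw [IncidenceAlgebra.mul_apply]
  refine Finset.sum_eq_zero fun z hz => ?_
  rw [kernelAlong_eq_zero, zero_mul]
  rintro ⟨h1, rfl⟩
  exact h ⟨h1, (Finset.mem_Icc.1 hz).2⟩

/-- At `(x, y)` the left side is `(X - 1) ^ ρ(x, y)` times an alternating sum over the `z ≱ q` with
`z ⊔ q = y`. Weisner's theorem evaluates this sum, giving `-κ x y`. On the right only `z = x ⊔ q`
contributes, and the two powers of `X - 1` multiply to `κ x y`. -/
theorem eulerianKernel_mul_rev_kernelAlong (h : IsLowerEulerian ρ) :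
    eulerianKernel ρ * rev ρ (kernelAlong ρ q) = -(kernelAlong ρ q * eulerianKernel ρ) := by
  classical
  ext1 x y hxy
  have h1 : (eulerianKernel ρ * rev ρ (kernelAlong ρ q)) x y =
      ∑ z ∈ Finset.Icc x y with ¬ q ≤ z ∧ z ⊔ q = y,
        eulerianKernel ρ x z * rev ρ (eulerianKernel ρ) z y := by
    rw [IncidenceAlgebra.mul_apply, Finset.sum_filter]
    refine Finset.sum_congr rfl fun z _ => ?_
    rw [rev_apply, kernelAlong_apply]
    split_ifs
    · rfl
    · rw [reflect_zero, mul_zero]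
  rw [h1, IncidenceAlgebra.neg_apply]
  by_cases hx : ¬ q ≤ x ∧ x ⊔ q ≤ y
  · have hsq : (((ρ y).negOnePow : ℤˣ) : ℤ) * (((ρ y).negOnePow : ℤˣ) : ℤ) = 1 := by
      rw [← Units.val_mul, Int.units_mul_self, Units.val_one]
    rw [sum_eulerianKernel_mul_rev h.isRankFunction (Finset.filter_subset _ _),
      h.sum_not_le_sup_eq hx.1 hx.2, kernelAlong_mul_eulerianKernel h.isRankFunction hx.1 hx.2,
      eulerianKernel_apply hxy, mul_neg, hsq]
    simp
  · rw [kernelAlong_mul_eulerianKernel_eq_zero hx, neg_zero]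
    refine Finset.sum_eq_zero fun z hz => absurd ?_ hx
    obtain ⟨hz1, hz2, rfl⟩ := Finset.mem_filter.1 hz
    have hxz := (Finset.mem_Icc.1 hz1).1
    exact ⟨fun hq => hz2 (hq.trans hxz), sup_le_sup_right hxz q⟩

/-- The division is exact: `kernelAlong` lives on intervals of positive rank, where the power of `X
- 1` vanishes at 1. -/
theorem X_sub_one_smul_hPoly (h : IsLowerEulerian ρ) :
    (X - 1 : ℤ[X]) • hPoly ρ q = leftKLS ρ * kernelAlong ρ q := by
  ext1 x y hxy
  have h1 : (X - 1 : ℤ[X]) = X - C 1 := by rw [map_one]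
  change (X - 1 : ℤ[X]) * ((leftKLS ρ * kernelAlong ρ q) x y /ₘ (X - 1)) = _
  rw [h1, mul_divByMonic_eq_iff_isRoot, IsRoot.def, IncidenceAlgebra.mul_apply, eval_finsetSum]
  refine Finset.sum_eq_zero fun z hz => ?_
  classical
  rw [eval_mul, kernelAlong_apply]
  split_ifs with hz'
  · have hlt : z < y := lt_of_le_of_ne (Finset.mem_Icc.1 hz).2 fun he =>
      hz'.1 (by rw [he, ← hz'.2]; exact le_sup_right)
    rw [eulerianKernel_apply hlt.le, eval_pow]
    simp [(wr_pos h.isRankFunction hlt).ne']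
  · simp

/-- The terms `z ≥ q` form the first product. For `z ≱ q` the step from `z` to `y` factors through
`z ⊔ q`. -/
theorem mul_eulerianKernel_eq_restrictAbove_add (h : IsRankFunction ρ)
    (f : IncidenceAlgebra ℤ[X] Γ) {x y : Γ} (hy : q ≤ y) :
    (f * eulerianKernel ρ) x y = (restrictAbove q f * eulerianKernel ρ) x y +
      (f * (kernelAlong ρ q * eulerianKernel ρ)) x y := by
  rw [IncidenceAlgebra.mul_apply f, IncidenceAlgebra.mul_apply (restrictAbove q f),
    IncidenceAlgebra.mul_apply f, ← Finset.sum_add_distrib]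
  refine Finset.sum_congr rfl fun z hz => ?_
  by_cases hqz : q ≤ z
  · rw [restrictAbove_of_le hqz, kernelAlong_mul_eulerianKernel_eq_zero fun h => h.1 hqz, mul_zero,
      add_zero]
  · rw [restrictAbove_of_not_le hqz, zero_mul, zero_add,
      kernelAlong_mul_eulerianKernel h hqz (sup_le (Finset.mem_Icc.1 hz).2 hy)]

theorem mul_neg_eq (f g : IncidenceAlgebra ℤ[X] Γ) : f * -g = -(f * g) := by
  ext1 x y _
  simp only [IncidenceAlgebra.mul_apply, IncidenceAlgebra.neg_apply, mul_neg,
    Finset.sum_neg_distrib]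

theorem neg_mul_eq (f g : IncidenceAlgebra ℤ[X] Γ) : -f * g = -(f * g) := by
  ext1 x y _
  simp only [IncidenceAlgebra.mul_apply, IncidenceAlgebra.neg_apply, neg_mul,
    Finset.sum_neg_distrib]

theorem apply_eq_sub_of_mul_eq {f g p : IncidenceAlgebra ℤ[X] Γ} (hg : ∀ z, g z z = 1)
    (h : f * g = p) {x y : Γ} (hxy : x ≤ y) :
    f x y = p x y - ∑ z ∈ Finset.Ico x y, f x z * g z y := by
  classical
  rw [← h, IncidenceAlgebra.mul_apply, ← Finset.Ico_insert_right hxy, Finset.sum_insert (by simp),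
    hg, mul_one, add_sub_cancel_right]

variable [DecidableEq Γ]

theorem isUnit_leftKLS (h : IsLowerEulerian ρ) : IsUnit (leftKLS ρ) := by
  have := h.finite
  exact IncidenceAlgebra.isUnit_of_apply_self (isLeftKLS_leftKLS h).apply_self

theorem isUnit_eulerianKernel (h : IsLowerEulerian ρ) : IsUnit (eulerianKernel ρ) := by
  have := h.finite
  exact IncidenceAlgebra.isUnit_of_apply_self eulerianKernel_self

theorem localH_mul_leftKLS (h : IsLowerEulerian ρ) :
    localH ρ q * leftKLS ρ = hPoly ρ q := by
  rw [localH, mul_assoc, Ring.inverse_mul_cancel _ (isUnit_leftKLS h), mul_one]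

theorem X_sub_one_smul_localH_mul (h : IsLowerEulerian ρ) :
    ((X - 1 : ℤ[X]) • localH ρ q) * leftKLS ρ = leftKLS ρ * kernelAlong ρ q := by
  rw [← X_sub_one_smul_hPoly h, ← localH_mul_leftKLS h]
  ext1 x y _
  simp only [IncidenceAlgebra.mul_apply, IncidenceAlgebra.constSMul_apply, Finset.smul_sum,
    smul_mul_assoc]

/-- This bound is what makes reversal multiplicative on the product with `leftKLS ρ`. -/
theorem degreeLE_X_sub_one_smul_localH (h : IsLowerEulerian ρ) :
    DegreeLE ρ ((X - 1 : ℤ[X]) • localH ρ q) := by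
  have := h.finite
  have hr := h.isRankFunction
  have hg := isLeftKLS_leftKLS h
  intro x y
  induction y using WellFoundedLT.induction with
  | _ y ih =>
  by_cases hxy : x ≤ y
  · rw [apply_eq_sub_of_mul_eq hg.apply_self (X_sub_one_smul_localH_mul h) hxy]
    refine (natDegree_sub_le _ _).trans (max_le (hg.degreeLE.mul hr degreeLE_kernelAlong x y) ?_)
    refine natDegree_sum_le_of_forall_le _ _ fun z hz => ?_
    obtain ⟨h1, h2⟩ := Finset.mem_Ico.1 hz
    rw [← wr_add hr h1 h2.le]
    exact natDegree_mul_le_of_le (ih z h2) (hg.degreeLE z y)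
  · rw [IncidenceAlgebra.apply_eq_zero_of_not_le hxy, natDegree_zero]
    exact Nat.zero_le _

theorem X_sub_one_smul_localH_eq_zero (h : IsLowerEulerian ρ) {y : Γ} (hy : ¬ q ≤ y) (x : Γ) :
    ((X - 1 : ℤ[X]) • localH ρ q) x y = 0 := by
  have := h.finite
  have hg := isLeftKLS_leftKLS h
  induction y using WellFoundedLT.induction with
  | _ y ih =>
  by_cases hxy : x ≤ y
  · rw [apply_eq_sub_of_mul_eq hg.apply_self (X_sub_one_smul_localH_mul h) hxy,
      IncidenceAlgebra.mul_apply, Finset.sum_eq_zero, Finset.sum_eq_zero, sub_zero]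
    · intro z hz
      have hz' := (Finset.mem_Ico.1 hz).2
      rw [ih z hz' fun hq => hy (hq.trans hz'.le), zero_mul]
    · intro z _
      rw [kernelAlong_eq_zero, mul_zero]
      rintro ⟨-, rfl⟩
      exact hy le_sup_right
  · exact IncidenceAlgebra.apply_eq_zero_of_not_le hxy _

/-- Reversing `L * g = g * κ_σ` and moving `κ` past the reversed `κ_σ` at the cost of a sign gives
`L^rev * (g * κ) = -L * (g * κ)`; the unit `g * κ` cancels. -/
theorem rev_X_sub_one_smul_localH (h : IsLowerEulerian ρ) :
    rev ρ ((X - 1 : ℤ[X]) • localH ρ q) = -((X - 1 : ℤ[X]) • localH ρ q) := by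
  have hr := h.isRankFunction
  have hg := isLeftKLS_leftKLS h
  have h1 := congrArg (rev ρ) (X_sub_one_smul_localH_mul (q := q) h)
  rw [rev_mul hr (degreeLE_X_sub_one_smul_localH h) hg.degreeLE,
    rev_mul hr hg.degreeLE degreeLE_kernelAlong, hg.rev_eq, mul_assoc (leftKLS ρ),
    eulerianKernel_mul_rev_kernelAlong h, mul_neg_eq, ← mul_assoc (leftKLS ρ),
    ← X_sub_one_smul_localH_mul h, mul_assoc _ (leftKLS ρ), ← neg_mul_eq] at h1
  exact ((isUnit_leftKLS h).mul (isUnit_eulerianKernel h)).mul_right_cancel h1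

theorem isSymmetric_localH (h : IsLowerEulerian ρ) {x y : Γ} {m : ℕ} (hm : wr ρ x y = m + 1) :
    IsSymmetric m (localH ρ q x y) := by
  refine isSymmetric_of_reflect ?_ ?_
  · rw [← hm]
    exact degreeLE_X_sub_one_smul_localH h x y
  · have := congrArg (fun f => f x y) (rev_X_sub_one_smul_localH (q := q) h)
    rw [← hm]
    exact this

/-- The differences `Δ ℓ_σ`, as an element of the incidence algebra. -/
noncomputable def deltaLocalH (ρ : Γ → ℤ) (q : Γ) : IncidenceAlgebra ℤ[X] Γ where
  toFun := fun x y => lowerHalf (wr ρ x y) (-((X - 1) * localH ρ q x y))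
  eq_zero_of_not_le' := fun x y h => by
    rw [IncidenceAlgebra.apply_eq_zero_of_not_le h]
    simp [lowerHalf]

theorem deltaLocalH_apply (x y : Γ) :
    deltaLocalH ρ q x y = lowerHalf (wr ρ x y) (-((X - 1 : ℤ[X]) • localH ρ q) x y) := rfl

theorem deltaLocalH_eq_delta {x y : Γ} {m : ℕ} (hm : wr ρ x y = m + 1) :
    deltaLocalH ρ q x y = delta m (localH ρ q x y) := by
  rw [delta_eq_lowerHalf, deltaLocalH_apply, hm]
  rfl

theorem deltaLocalH_eq_zero (h : IsLowerEulerian ρ) {y : Γ} (hy : ¬ q ≤ y) (x : Γ) :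
    deltaLocalH ρ q x y = 0 := by
  rw [deltaLocalH_apply, X_sub_one_smul_localH_eq_zero h hy]
  simp [lowerHalf]

theorem degreeLE_deltaLocalH : DegreeLE ρ (deltaLocalH ρ q) :=
  fun _ _ => natDegree_lowerHalf_le _ _

theorem rev_deltaLocalH (h : IsLowerEulerian ρ) :
    rev ρ (deltaLocalH ρ q) = deltaLocalH ρ q + (X - 1 : ℤ[X]) • localH ρ q := by
  ext1 x y _
  have h1 := congrArg (fun f => f x y) (rev_X_sub_one_smul_localH (q := q) h)
  rw [rev_apply, IncidenceAlgebra.neg_apply] at h1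
  have h2 := lowerHalf_sub_reflect (n := wr ρ x y) (p := -((X - 1 : ℤ[X]) • localH ρ q) x y)
    (by rw [natDegree_neg]; exact degreeLE_X_sub_one_smul_localH h x y) (by rw [reflect_neg, h1])
  rw [rev_apply, IncidenceAlgebra.add_apply, deltaLocalH_apply]
  linear_combination -h2

/-- The recursion of the relative `g`-polynomials is solved by the differences `Δ ℓ_σ`. -/
theorem deltaLocalH_mul_leftKLS (h : IsLowerEulerian ρ) {x y : Γ} (hx : ¬ q ≤ x) (hxy : x ≤ y)
    (hy : q ≤ y) : (deltaLocalH ρ q * leftKLS ρ) x y = leftKLS ρ x y := by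
  have := h.finite
  have hr := h.isRankFunction
  have hg := isLeftKLS_leftKLS h
  rw [← sub_eq_zero, ← restrictAbove_of_le (f := leftKLS ρ) hy, ← IncidenceAlgebra.sub_apply]
  -- The difference of `D * g` and the part of `g` above `q` is treated as a whole row, including
  -- the `y ≱ q`, where it vanishes.
  refine eq_zero_of_rev_eq (ρ := ρ) (fun y hxy => ?_) y hxy
  by_cases hy : q ≤ y
  swap
  · refine .inl ?_
    rw [IncidenceAlgebra.sub_apply, restrictAbove_of_not_le hy, IncidenceAlgebra.mul_apply,
      Finset.sum_eq_zero, sub_zero]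
    intro z hz
    rw [deltaLocalH_eq_zero h fun hq => hy (hq.trans (Finset.mem_Icc.1 hz).2), zero_mul]
  have hlt : x < y := lt_of_le_of_ne hxy fun he => hx (he ▸ hy)
  refine .inr ⟨?_, ?_⟩
  · rw [IncidenceAlgebra.sub_apply, restrictAbove_of_le hy]
    refine two_mul_natDegree_sub_lt ?_ (hg.degree_lt x y hlt)
    have hpos := wr_pos hr hlt
    suffices ((deltaLocalH ρ q * leftKLS ρ) x y).natDegree ≤ (wr ρ x y - 1) / 2 by omega
    rw [IncidenceAlgebra.mul_apply]
    refine natDegree_sum_le_of_forall_le _ _ fun z hz => ?_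
    obtain ⟨h1, h2⟩ := Finset.mem_Icc.1 hz
    -- The diagonal entry of `D` is zero since `x ≱ q`. Every other factor `D x z` is strictly below
    -- half degree, which keeps the product strictly below.
    rcases h1.eq_or_lt with rfl | h1
    · rw [deltaLocalH_eq_zero h hx, zero_mul, natDegree_zero]
      exact Nat.zero_le _
    · have h3 : 2 * (deltaLocalH ρ q x z).natDegree < wr ρ x z :=
        two_mul_natDegree_lowerHalf (wr_pos hr h1) _
      have h4 := hg.two_mul_natDegree_le z y
      have h5 := wr_add hr h1.le h2
      have h6 := natDegree_mul_le (p := deltaLocalH ρ q x z) (q := leftKLS ρ z y)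
      omega
  · have h1 : rev ρ (restrictAbove q (leftKLS ρ)) x y = (leftKLS ρ * eulerianKernel ρ) x y := by
      rw [rev_apply, restrictAbove_of_le hy, ← hg.rev_eq, rev_apply]
    -- Here `(D * g)^rev = (D + L) * g * κ = D * g * κ + g * κ_σ * κ`, and the last term is exactly
    -- what separates `g * κ` from `(g above q) * κ`.
    rw [rev_sub, sub_mul_apply, h1, mul_eulerianKernel_eq_restrictAbove_add hr _ hy,
      rev_mul hr degreeLE_deltaLocalH hg.degreeLE, hg.rev_eq, rev_deltaLocalH h, add_mul,
      ← mul_assoc _ (leftKLS ρ), ← mul_assoc _ (leftKLS ρ), X_sub_one_smul_localH_mul h,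
      ← mul_assoc (leftKLS ρ), IncidenceAlgebra.add_apply]
    ring

end LocalH

end KLS

/-! ### The relative `g`-polynomial -/

/-- The image is a lower set, so intervals correspond and the pullback of `leftKLS ρB` satisfies the
defining conditions; uniqueness does the rest. It identifies the `g`-polynomials of a face with
entries of the one incidence algebra of `Q`. -/
theorem KLS.leftKLS_orderEmbedding {A B : Type*} [PartialOrder A] [LocallyFiniteOrder A]
    [PartialOrder B] [LocallyFiniteOrder B] {ρA : A → ℤ} {ρB : B → ℤ} (f : A ↪o B)
    (hf : ∀ a b, b ≤ f a → ∃ a', f a' = b) (hρ : ∀ a, ρA a = ρB (f a)) (hA : IsLowerEulerian ρA)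
    (hB : IsLowerEulerian ρB) (x y : A) : leftKLS ρA x y = leftKLS ρB (f x) (f y) := by
  have := hA.finite
  have hg := isLeftKLS_leftKLS hB
  have hwr : ∀ x y, wr ρA x y = wr ρB (f x) (f y) := fun x y => by rw [wr, wr, hρ, hρ]
  have hκ : ∀ x y, eulerianKernel ρA x y = eulerianKernel ρB (f x) (f y) := by
    intro x y
    by_cases hxy : x ≤ y
    · rw [eulerianKernel_apply hxy, eulerianKernel_apply (f.le_iff_le.2 hxy), hwr]
    · rw [IncidenceAlgebra.apply_eq_zero_of_not_le hxy,
        IncidenceAlgebra.apply_eq_zero_of_not_le (mt f.le_iff_le.1 hxy)]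
  let p : IncidenceAlgebra ℤ[X] A := ⟨fun x y => leftKLS ρB (f x) (f y), fun x y h =>
    IncidenceAlgebra.apply_eq_zero_of_not_le (mt f.le_iff_le.1 h) _⟩
  have hp : IsLeftKLS ρA (eulerianKernel ρA) p := by
    refine ⟨fun z => hg.apply_self _, fun x y hxy => ?_, ?_⟩
    · rw [hwr]
      exact hg.degree_lt _ _ (f.lt_iff_lt.2 hxy)
    · ext1 x y _
      have h1 : Finset.Icc (f x) (f y) = (Finset.Icc x y).map f.toEmbedding := by
        ext b
        rw [Finset.mem_Icc, Finset.mem_map]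
        constructor
        · rintro ⟨h1, h2⟩
          obtain ⟨a, rfl⟩ := hf y b h2
          exact ⟨a, Finset.mem_Icc.2 ⟨f.le_iff_le.1 h1, f.le_iff_le.1 h2⟩, rfl⟩
        · rintro ⟨a, ha, rfl⟩
          obtain ⟨h1, h2⟩ := Finset.mem_Icc.1 ha
          exact ⟨f.le_iff_le.2 h1, f.le_iff_le.2 h2⟩
      have h2 : rev ρA p x y = rev ρB (leftKLS ρB) (f x) (f y) := by
        rw [rev_apply, rev_apply, hwr]
        rfl
      rw [h2, hg.rev_eq, IncidenceAlgebra.mul_apply, IncidenceAlgebra.mul_apply, h1,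
        Finset.sum_map]
      exact Finset.sum_congr rfl fun z _ => by rw [hκ]; rfl
  exact congrArg (fun g => g x y) ((isLeftKLS_leftKLS hA).unique hp)

namespace Polytope

variable {V : Type*} [AddCommGroup V] [Module ℝ V]

theorem eq_of_carrier_eq {P P' : Polytope V} (h : P.carrier = P'.carrier) : P = P' := by
  cases P
  cases P'
  congr

theorem Face.ext_carrier {P : Polytope V} {G H : Face P} (h : G.carrier = H.carrier) : G = H :=
  Subtype.ext h

theorem relativeG_congr {P P' : Polytope V} (h : P.carrier = P'.carrier) {F : Face P}
    {F' : Face P'} (hF : F.carrier = F'.carrier) : P.relativeG F = P'.relativeG F' := by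
  obtain rfl := eq_of_carrier_eq h
  rw [Face.ext_carrier hF]

/-- A face of a face of a polytope is a face. -/
theorem IsFace.trans {Q : Polytope V} {E : Face Q} {G : Set V} (hG : E.toPolytope.IsFace G) :
    Q.IsFace G := by
  classical
  obtain ⟨s, hs⟩ := Q.exists_finset
  have hEs : E.toPolytope.carrier = convexHull ℝ ((s.filter (· ∈ E.1) : Finset V) : Set V) :=
    E.2.eq_convexHull hs
  have hGs := hG.eq_convexHull hEs
  have hGE : ∀ v ∈ G, v ∈ E.1 := fun v hv => hG.subset hv
  obtain ⟨l, c, hl, hE⟩ := E.2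
  obtain ⟨m, d, hm, hG'⟩ := hG
  have hsQ : ∀ v ∈ s, v ∈ Q.carrier := fun v hv => hs ▸ subset_convexHull ℝ _ hv
  have hEmem : ∀ v ∈ s, v ∈ E.1 ↔ l v = c := fun v hv => by
    rw [hE]
    exact and_iff_right (hsQ v hv)
  have hGmem : ∀ v, v ∈ G ↔ v ∈ E.1 ∧ m v = d := fun v => by
    rw [hG']
    rfl
  -- The functional `N • l + m` cuts out `G` once `N` is so large that the slack of `l` off `E`
  -- outweighs any excess of `m` at the finitely many points of `s`.
  have hN : ∀ᶠ N in Filter.atTop, ∀ v ∈ s, v ∉ E.1 → m v - d < N * (c - l v) := by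
    refine (Filter.eventually_all_finset s).2 fun v hv => ?_
    by_cases hvE : v ∈ E.1
    · exact Filter.Eventually.of_forall fun _ h => absurd hvE h
    · have hpos : 0 < c - l v :=
        sub_pos.2 (lt_of_le_of_ne (hl v (hsQ v hv)) fun h => hvE ((hEmem v hv).2 h))
      filter_upwards [Filter.eventually_gt_atTop ((m v - d) / (c - l v))] with N hN _
      exact (div_lt_iff₀ hpos).1 hN
  obtain ⟨N, hN⟩ := hN.exists
  have hval : ∀ v ∈ s, (N • l + m) v ≤ N * c + d ∧ ((N • l + m) v = N * c + d ↔ v ∈ G) := by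
    intro v hv
    rw [hGmem, LinearMap.add_apply, LinearMap.smul_apply, smul_eq_mul]
    by_cases hvE : v ∈ E.1
    · have h1 := (hEmem v hv).1 hvE
      have h2 := hm v hvE
      rw [h1]
      exact ⟨by linarith, fun h => ⟨hvE, by linarith⟩, fun h => by rw [h.2]⟩
    · have := hN v hv hvE
      exact ⟨by linarith, fun h => by linarith, fun h => absurd h.1 hvE⟩
  have hface : Q.IsFace {x ∈ Q.carrier | (N • l + m) x = N * c + d} := by
    refine ⟨_, _, fun x hx => ?_, rfl⟩
    have hconv : Convex ℝ {x | (N • l + m) x ≤ N * c + d} :=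
      convex_halfSpace_le (LinearMap.isLinear _) _
    rw [hs] at hx
    exact convexHull_min (fun v hv => (hval v hv).1) hconv hx
  obtain ⟨H, hH⟩ : ∃ H, H = {x ∈ Q.carrier | (N • l + m) x = N * c + d} := ⟨_, rfl⟩
  rw [← hH] at hface
  have hHG : ∀ v ∈ s, v ∈ H ↔ v ∈ E.1 ∧ v ∈ G := fun v hv => by
    rw [hH]
    exact ⟨fun h => ⟨hGE v ((hval v hv).2.1 h.2), (hval v hv).2.1 h.2⟩,
      fun h => ⟨hsQ v hv, (hval v hv).2.2 h.2⟩⟩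
  have hfilter : (s.filter (· ∈ H)) = (s.filter (· ∈ E.1)).filter (· ∈ G) := by
    rw [Finset.filter_filter]
    exact Finset.filter_congr hHG
  rw [hGs, ← hfilter, ← hface.eq_convexHull hs]
  exact hface

namespace Face

variable {Q : Polytope V}

/-- The inclusion of the face lattice of a face. -/
def ofFace (E : Face Q) : Face E.toPolytope ↪o Face Q :=
  OrderEmbedding.ofMapLEIff (fun G => ⟨G.1, G.2.trans⟩) fun _ _ => Iff.rfl

theorem ofFace_le {E : Face Q} (G : Face E.toPolytope) : E.ofFace G ≤ E := G.2.subset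

theorem ofFace_bot (E : Face Q) : E.ofFace ⊥ = ⊥ := rfl

theorem ofFace_top (E : Face Q) : E.ofFace ⊤ = E := rfl

theorem rank_ofFace {E : Face Q} (G : Face E.toPolytope) :
    E.toPolytope.rank G = Q.rank (E.ofFace G) := rfl

end Face

variable {Q : Polytope V}

theorem leftKLS_toPolytope (E : Face Q) (x y : Face E.toPolytope) :
    KLS.leftKLS E.toPolytope.rank x y = KLS.leftKLS Q.rank (E.ofFace x) (E.ofFace y) :=
  KLS.leftKLS_orderEmbedding E.ofFace
    (fun a b hb => ⟨b.restrict E (hb.trans (Face.ofFace_le a)), rfl⟩) Face.rank_ofFace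
    E.toPolytope.isLowerEulerian_rank Q.isLowerEulerian_rank x y

/-- Both sides satisfy the same recursion over the faces between `F` and `E`; the terms not above
`F` vanish on the right. All faces `E` are handled inside the face lattice of `Q`, so that induction
applies. -/
theorem relativeG_restrict {F : Face Q} (hF : ¬ F ≤ ⊥) (E : Face Q) (hFE : F ≤ E) :
    E.toPolytope.relativeG (F.restrict E hFE) = KLS.deltaLocalH Q.rank F ⊥ E := by
  classical
  have hQ := Q.isLowerEulerian_rank
  induction E using WellFoundedLT.induction with
  | _ E ih =>
  have hrec := KLS.deltaLocalH_mul_leftKLS hQ hF bot_le hFE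
  rw [IncidenceAlgebra.mul_apply, ← Finset.Ico_insert_right bot_le, Finset.sum_insert (by simp),
    (KLS.isLeftKLS_leftKLS hQ).apply_self, mul_one] at hrec
  rw [relativeG, g, leftKLS_toPolytope, Face.ofFace_bot, Face.ofFace_top, ← hrec]
  refine sub_eq_of_eq_add (congrArg (_ + ·) ?_)
  rw [← Finset.sum_filter_of_ne (p := fun z => F ≤ z)]
  swap
  · intro z _ hz
    by_contra hFz
    exact hz (by rw [KLS.deltaLocalH_eq_zero hQ hFz, zero_mul])
  symm
  refine Finset.sum_nbij (fun E' => E.ofFace E'.1) ?_ ?_ ?_ ?_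
  · intro E' _
    refine Finset.mem_filter.2 ⟨Finset.mem_Ico.2 ⟨bot_le, ?_⟩, E'.2.1⟩
    exact E.ofFace.lt_iff_lt.2 E'.2.2
  · exact fun E₁ _ E₂ _ h => Subtype.ext (E.ofFace.injective h)
  · intro z hz
    obtain ⟨hz1, hz2⟩ := Finset.mem_filter.1 hz
    have hzE := (Finset.mem_Ico.1 hz1).2
    refine ⟨⟨z.restrict E hzE.le, hz2, ?_⟩, Finset.mem_coe.2 (Finset.mem_univ _), rfl⟩
    exact E.ofFace.lt_iff_lt.1 hzE
  · intro E' _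
    have hlt : E.ofFace E'.1 < E := E.ofFace.lt_iff_lt.2 E'.2.2
    have h1 : F ≤ E.ofFace E'.1 := E'.2.1
    rw [← ih _ hlt h1, gQuotient, leftKLS_toPolytope, Face.ofFace_top]
    congr 1

theorem relativeG_eq {F : Face Q} (hF : ¬ F ≤ ⊥) :
    Q.relativeG F = KLS.deltaLocalH Q.rank F ⊥ ⊤ := by
  rw [← relativeG_restrict hF ⊤ le_top]
  exact relativeG_congr rfl rfl

theorem wr_bot_top (hQ : Q.carrier.Nonempty) : KLS.wr Q.rank ⊥ ⊤ = Q.dim + 1 := by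
  have h1 : Q.rank ⊥ = 0 := by
    have hbot : (⊥ : Face Q).toPolytope.carrier = ∅ := rfl
    rw [rank, dimSucc, if_pos hbot, Nat.cast_zero]
  have h2 : Q.rank ⊤ = (Q.dim + 1 : ℕ) := by
    change ((Q.dimSucc : ℕ) : ℤ) = _
    rw [dimSucc, if_neg hQ.ne_empty]
  rw [KLS.wr, h1, h2, sub_zero, Int.toNat_natCast]

end Polytope

theorem mainTheorem5 {V : Type*} [AddCommGroup V] [Module ℝ V]
    (Q : Polytope V) (F : Polytope.Face Q) (hF : F.carrier.Nonempty) :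
    -- the face lattice is Eulerian and `σ` is a strong formal subdivision
    IsLowerEulerian Q.rank ∧
    IsStrongFormalSubdivision (sourceRank Q.rank F) (targetRank Q.rank F) (subdivisionMap F) ∧
    -- the polynomials `g`, `h_σ`, `ℓ_σ` are well defined, and `ℓ_σ` is symmetric
    (∃! g, KLS.IsLeftKLS Q.rank (KLS.eulerianKernel Q.rank) g) ∧
    (Polynomial.X - 1 : Polynomial ℤ) • KLS.hPoly Q.rank F =
      KLS.leftKLS Q.rank * KLS.kernelAlong Q.rank F ∧
    KLS.localH Q.rank F * KLS.leftKLS Q.rank = KLS.hPoly Q.rank F ∧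
    KLS.IsSymmetric Q.dim (KLS.localH Q.rank F ⊥ ⊤) ∧
    -- the relative `g`-polynomial is `Δ ℓ_σ`
    Q.relativeG F = KLS.delta Q.dim (KLS.localH Q.rank F ⊥ ⊤) ∧
    (KLS.Nonneg (Q.relativeG F) ↔
      KLS.Nonneg (KLS.localH Q.rank F ⊥ ⊤) ∧ KLS.Unimodal (KLS.localH Q.rank F ⊥ ⊤)) := by

  have hQ := Q.isLowerEulerian_rank
  have hbot : ¬ F ≤ ⊥ := fun h => hF.elim fun x hx => h hx
  have hwr := Polytope.wr_bot_top (hF.mono F.2.subset)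
  have hsymm := KLS.isSymmetric_localH (q := F) hQ hwr
  have hrel : Q.relativeG F = KLS.delta Q.dim (KLS.localH Q.rank F ⊥ ⊤) := by
    rw [Polytope.relativeG_eq hbot, KLS.deltaLocalH_eq_delta hwr]
  refine ⟨hQ, hQ.isStrongFormalSubdivision ⟨⊥, hbot⟩, KLS.existsUnique_isLeftKLS hQ,
    KLS.X_sub_one_smul_hPoly hQ, KLS.localH_mul_leftKLS hQ, hsymm, hrel, ?_⟩
  rw [hrel]
  exact KLS.nonneg_delta_iff hsymm
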